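/- There is a universal constant $C>0$ such that for every real $t \ge 1$ and every $\eta \in (0,1/2)$ there is a quantum query algorithm $A=A_{t,\eta}$ with the following properties. The algorithm acts on a system register together with a finite-dimensional workspace that starts in a fixed basis state. It alternates unitaries on the workspace with applications of two unknown operators to the system register, each application being controlled on the state of the workspace. It ends with a measurement of the workspace in the computational basis, and it computes its output $\tilde p \in [0,1]$ from the outcome. It makes at most $C\,t\log(1/\eta)$ controlled applications of the two operators in total. The algorithm does not depend on the Hilbert space, the state or the projection below. For every complex Hilbert space $\mathcal H$, every unit vector $|\psi\rangle\in\mathcal H$ and every orthogonal projection $\Pi$ on $\mathcal H$, put $p=\|\Pi|\psi\rangle\|^2$. When $A$ is run on one copy of $|\psi\rangle$ with the two operators $\mathrm{id}-2|\psi\rangle\langle\psi|$ and $\mathrm{id}-2\Pi$, then 1. with probability at least $1-\eta$ the output satisfies $|\tilde p-p|<\dfrac{\sqrt{p(1-p)}}{t}+\dfrac1{t^2}$; 2. if $p\le 1/(4t^2)$, then $\tilde p=0$ with probability at least $1-\eta$; 3. $|\psi\rangle$ is restored with probability at least $1-\eta$, that is, after the run the measurement $\{|\psi\rangle\langle\psi|,\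 \mathrm{id}-|\psi\rangle\langle\psi|\}$ of the system register returns $|\psi\rangle$ with probability at least $1-\eta$. -/

import Mathlib

/-- One step of a quantum algorithm that acts on `H ⊗ ℂ^W`, where `H` is the (unknown) system
space and `ℂ^W` is a finite-dimensional workspace with computational basis `W`. A gate is either
* a unitary on the workspace alone, or
* one application of the first or of the second oracle operator to the system, controlled on the
  workspace basis state lying in `S`.
Gates are pure syntax: they mention neither the system space nor the oracle operators. -/
inductive OracleGate (W : Type) [Fintype W] [DecidableEq W] : Type where
  | work (U : Matrix.unitaryGroup W ℂ) : OracleGate W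
  | queryFst (S : Finset W) : OracleGate W
  | querySnd (S : Finset W) : OracleGate W

namespace OracleGate

variable {W : Type} [Fintype W] [DecidableEq W]

/-- Number of oracle applications made by a gate. -/
def cost : OracleGate W → ℕ
  | work _ => 0
  | queryFst _ => 1
  | querySnd _ => 1

/-- Action of a gate on a vector of `H ⊗ ℂ^W`, for oracle operators `R₁, R₂` on `H`. The vector
`∑ w, x w ⊗ |w⟩` is represented by the family of its components `x : W → H`. -/
def apply {H : Type*} [NormedAddCommGroup H] [InnerProductSpace ℂ H] (R₁ R₂ : H →L[ℂ] H) :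
    OracleGate W → (W → H) → (W → H)
  | work U, x => fun w => ∑ v, (U : Matrix W W ℂ) w v • x v
  | queryFst S, x => fun w => if w ∈ S then R₁ (x w) else x w
  | querySnd S, x => fun w => if w ∈ S then R₂ (x w) else x w

end OracleGate

/-- A quantum query algorithm with two oracles, one input copy of a system state and a real
output: a finite list of gates (the head of the list is applied first), followed by a measurement
of the workspace in the computational basis and a classical post-processing of the outcome.
The data does not depend on the system space, on the input state or on the oracles. -/
structure QueryAlgorithm where
  /-- Computational basis of the workspace. -/
  Work : Type
  [fintypeWork : Fintype Work]
  [decEqWork : DecidableEq Work]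
  /-- Initial basis state of the workspace. -/
  init : Work
  /-- The circuit. -/
  gates : List (OracleGate Work)
  /-- The real number that is returned on each measurement outcome. -/
  output : Work → ℝ

attribute [instance] QueryAlgorithm.fintypeWork QueryAlgorithm.decEqWork

namespace QueryAlgorithm

/-- Total number of (controlled) applications of the two oracles. -/
def queries (A : QueryAlgorithm) : ℕ := (A.gates.map OracleGate.cost).sum

variable {H : Type*} [NormedAddCommGroup H] [InnerProductSpace ℂ H]

/-- The joint state `ψ ⊗ |init⟩` on which the circuit starts: one copy of `ψ`. -/
def initState (A : QueryAlgorithm) (ψ : H) : A.Work → H :=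
  fun w => if w = A.init then ψ else 0

/-- The joint state at the end of the circuit, before the measurement. -/
def finalState (A : QueryAlgorithm) (R₁ R₂ : H →L[ℂ] H) (ψ : H) : A.Work → H :=
  A.gates.foldl (fun x g => g.apply R₁ R₂ x) (A.initState ψ)

open Classical in
/-- Probability (Born rule) that the returned number satisfies `E`. -/
noncomputable def probOutput (A : QueryAlgorithm) (R₁ R₂ : H →L[ℂ] H) (ψ : H)
    (E : ℝ → Prop) : ℝ :=
  ∑ w with E (A.output w), ‖A.finalState R₁ R₂ ψ w‖ ^ 2

/-- Probability that the system is left in the state `ψ` at the end of the computation: the sum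
over the workspace outcomes `w` of the probability to observe `w` and then to find the system
in `ψ` when it is measured with `{|ψ⟩⟨ψ|, 1 - |ψ⟩⟨ψ|}`. -/
noncomputable def probRestored (A : QueryAlgorithm) (R₁ R₂ : H →L[ℂ] H) (ψ : H) : ℝ :=
  ∑ w, ‖inner ℂ ψ (A.finalState R₁ R₂ ψ w)‖ ^ 2

end QueryAlgorithm

/-- The reflection `1 - 2|ψ⟩⟨ψ|`. -/
noncomputable def stateReflection {H : Type*} [NormedAddCommGroup H] [InnerProductSpace ℂ H]
    (ψ : H) : H →L[ℂ] H :=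
  1 - (2 : ℂ) • InnerProductSpace.rankOne ℂ ψ ψ

/-- The reflection `1 - 2P` of a projection operator `P`. -/
noncomputable def projReflection {H : Type*} [NormedAddCommGroup H] [InnerProductSpace ℂ H]
    (P : H →L[ℂ] H) : H →L[ℂ] H :=
  1 - (2 : ℂ) • P

/-!
On the span of `ψ` and `P ψ`, a plane or a line, the product `R₁ R₂` of the reflections
`R₁ = 1 - 2|ψ⟩⟨ψ|` and `R₂ = 1 - 2P` is a rotation by an angle `β` with `cos β = 2 p - 1` and
`sin β = 2 √(p (1 - p))` (`exists_isRotationPlane`). So `p = (1 + cos β) / 2`, and `ψ` is a sum of two eigenvectors with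
eigenvalues `exp (± iβ)`, which give the same estimate of `p`.

Phase estimation with `K = ⌈23 t⌉` indices and the amplitudes `√(2/K) sin (π (k + 1) / K)` has
mean squared error `O(1 / K ^ 2)`. With this window the error is by Parseval the sum of the squared
differences of consecutive amplitudes (`sum_norm_sq_phaseAmplitude_mul_sin_sq_le`), so no tail of
a Fejér kernel has to be summed. By Markov's inequality one run misses the accuracy
`√(p (1 - p)) / t + 1 / t ^ 2` with probability at most `1 / 4`, and the median of
`2 N = O(log (1 / η))` runs on the same copy of `ψ` misses it with probability at most
`2 (3 / 4) ^ N` (`sum_finalState_power_le`).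

The runs leave the system entangled with their outcomes. Restoring `ψ` rests on two ideas.

* The median is computed coherently: its value is copied and the computation is undone. If one value
  is almost certain, this restores `ψ` (`sq_le_probRestored_coherent`). Medians below
  `1 / (2 t ^ 2)` are rounded to `0` and those above `1 - 1 / (2 t ^ 2)` to `1`. For `p` within
  `1 / (4 t ^ 2)` of an end the output is then almost certain, which also gives the output `0` that
  is asked for small `p`.
* For all other `p` the angle `β` is at distance of order `1 / t` from the multiples of `π`. Then
  the system can be returned by force: measure whether it is in `ψ` and, if not, apply `R₁ R₂` a
  random number of times below `K`. This brings it back with probability at least `1 / 4`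
  (`sum_defect_restoration`, `sum_cos_sq_le_of_sin`), so `N` rounds suffice. The rounds never
  increase the weight orthogonal to `ψ`, hence are harmless when `p` is near an end.
-/

/-! ### Circuits and their inverses -/

/-- A self-adjoint involution, that is, an operator `1 - 2P` with `P` an orthogonal projection. -/
structure IsReflection {H : Type*} [NormedAddCommGroup H] [InnerProductSpace ℂ H]
    (R : H →L[ℂ] H) : Prop where
  inner_left : ∀ x y, inner ℂ (R x) y = inner ℂ x (R y)
  involutive : ∀ x, R (R x) = x

namespace OracleGate

variable {W W' : Type} [Fintype W] [DecidableEq W] [Fintype W'] [DecidableEq W']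

/-- The inverse gate, when both oracles are involutions. -/
def inv : OracleGate W → OracleGate W
  | work U => work U⁻¹
  | queryFst S => queryFst S
  | querySnd S => querySnd S

/-- The gate on the first factor of a product workspace. -/
def liftLeft (W' : Type) [Fintype W'] [DecidableEq W'] : OracleGate W → OracleGate (W × W')
  | work U => work ⟨Matrix.kronecker (U : Matrix W W ℂ) (1 : Matrix W' W' ℂ),
      Matrix.kronecker_mem_unitary U.2 (one_mem _)⟩
  | queryFst S => queryFst (S ×ˢ Finset.univ)
  | querySnd S => querySnd (S ×ˢ Finset.univ)

/-- The gate on the second factor of a product workspace. -/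
def liftRight (W : Type) [Fintype W] [DecidableEq W] : OracleGate W' → OracleGate (W × W')
  | work U => work ⟨Matrix.kronecker (1 : Matrix W W ℂ) (U : Matrix W' W' ℂ),
      Matrix.kronecker_mem_unitary (one_mem _) U.2⟩
  | queryFst S => queryFst (Finset.univ ×ˢ S)
  | querySnd S => querySnd (Finset.univ ×ˢ S)

@[simp] lemma cost_inv (g : OracleGate W) : g.inv.cost = g.cost := by cases g <;> rfl

@[simp] lemma cost_liftLeft (g : OracleGate W) : (g.liftLeft W').cost = g.cost := by
  cases g <;> rfl

@[simp] lemma cost_liftRight (g : OracleGate W') : (g.liftRight W).cost = g.cost := by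
  cases g <;> rfl

variable {H : Type*} [NormedAddCommGroup H] [InnerProductSpace ℂ H] {R₁ R₂ : H →L[ℂ] H}

lemma apply_zero (g : OracleGate W) : g.apply R₁ R₂ 0 = 0 := by
  cases g <;> ext w <;> simp [apply]

lemma apply_add (g : OracleGate W) (x y : W → H) :
    g.apply R₁ R₂ (x + y) = g.apply R₁ R₂ x + g.apply R₁ R₂ y := by
  cases g <;> ext w <;> simp only [apply, Pi.add_apply, smul_add, Finset.sum_add_distrib, map_add]
  all_goals split_ifs <;> rfl

lemma apply_smul (g : OracleGate W) (c : ℂ) (x : W → H) :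
    g.apply R₁ R₂ (c • x) = c • g.apply R₁ R₂ x := by
  cases g <;> ext w <;> simp only [apply, Pi.smul_apply, map_smul, Finset.smul_sum]
  · simp only [smul_comm c]
  all_goals split_ifs <;> rfl

lemma apply_liftLeft (g : OracleGate W) (x : W × W' → H) (w : W) (w' : W') :
    (g.liftLeft W').apply R₁ R₂ x (w, w') = g.apply R₁ R₂ (fun v => x (v, w')) w := by
  cases g
  · simp [liftLeft, apply, Fintype.sum_prod_type, Matrix.one_apply]
  all_goals simp [liftLeft, apply]

lemma apply_liftRight (g : OracleGate W') (x : W × W' → H) (w : W) (w' : W') :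
    (g.liftRight W).apply R₁ R₂ x (w, w') = g.apply R₁ R₂ (fun v => x (w, v)) w' := by
  cases g
  · simp [liftRight, apply, Fintype.sum_prod_type_right, Matrix.one_apply]
  all_goals simp [liftRight, apply]

lemma apply_inv_apply (h₁ : IsReflection R₁) (h₂ : IsReflection R₂) (g : OracleGate W)
    (x : W → H) : g.inv.apply R₁ R₂ (g.apply R₁ R₂ x) = x := by
  cases g with
  | work U =>
    ext w
    have hU : star (U : Matrix W W ℂ) * U = 1 := Unitary.coe_star_mul_self U
    simp only [inv, apply, Finset.smul_sum, smul_smul]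
    rw [Finset.sum_comm]
    simp_rw [← Finset.sum_smul]
    have : ∀ v, ∑ u, ((U⁻¹ : Matrix.unitaryGroup W ℂ) : Matrix W W ℂ) w u * (U : Matrix W W ℂ) u v
        = (1 : Matrix W W ℂ) w v := by
      intro v
      rw [← hU, Matrix.mul_apply]; rfl
    rw [Finset.sum_congr rfl fun v _ => congrArg (· • x v) (this v)]
    simp [Matrix.one_apply]
  | queryFst S =>
    ext w; by_cases hw : w ∈ S <;> simp [inv, apply, hw, h₁.involutive]
  | querySnd S =>
    ext w; by_cases hw : w ∈ S <;> simp [inv, apply, hw, h₂.involutive]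

lemma inner_apply (h₁ : IsReflection R₁) (h₂ : IsReflection R₂) (g : OracleGate W)
    (x y : W → H) :
    ∑ w, inner ℂ (g.apply R₁ R₂ x w) (y w) = ∑ w, inner ℂ (x w) (g.inv.apply R₁ R₂ y w) := by
  cases g with
  | work U =>
    simp only [inv, apply, sum_inner, inner_sum, inner_smul_left, inner_smul_right]
    rw [Finset.sum_comm]
    rfl
  | queryFst S =>
    refine Finset.sum_congr rfl fun w _ => ?_
    by_cases hw : w ∈ S <;> simp [inv, apply, hw, h₁.inner_left]
  | querySnd S =>
    refine Finset.sum_congr rfl fun w _ => ?_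
    by_cases hw : w ∈ S <;> simp [inv, apply, hw, h₂.inner_left]

/-- The action of a list of gates, the head of the list first. -/
def run {H : Type*} [NormedAddCommGroup H] [InnerProductSpace ℂ H] (R₁ R₂ : H →L[ℂ] H)
    (l : List (OracleGate W)) (x : W → H) : W → H :=
  l.foldl (fun x g => g.apply R₁ R₂ x) x

@[simp] lemma run_nil (x : W → H) : run R₁ R₂ [] x = x := rfl

@[simp] lemma run_cons (g : OracleGate W) (l : List (OracleGate W)) (x : W → H) :
    run R₁ R₂ (g :: l) x = run R₁ R₂ l (g.apply R₁ R₂ x) := rfl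

@[simp] lemma run_append (l l' : List (OracleGate W)) (x : W → H) :
    run R₁ R₂ (l ++ l') x = run R₁ R₂ l' (run R₁ R₂ l x) := by
  simp [run]

lemma run_zero (l : List (OracleGate W)) : run R₁ R₂ l (0 : W → H) = 0 := by
  induction l with
  | nil => rfl
  | cons g l ih => rw [run_cons, apply_zero, ih]

lemma run_add (l : List (OracleGate W)) (x y : W → H) :
    run R₁ R₂ l (x + y) = run R₁ R₂ l x + run R₁ R₂ l y := by
  induction l generalizing x y with
  | nil => rfl
  | cons g l ih => rw [run_cons, apply_add, ih]; rfl

lemma run_smul (l : List (OracleGate W)) (c : ℂ) (x : W → H) :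
    run R₁ R₂ l (c • x) = c • run R₁ R₂ l x := by
  induction l generalizing x with
  | nil => rfl
  | cons g l ih => rw [run_cons, apply_smul, ih]; rfl

lemma run_map_liftLeft (l : List (OracleGate W)) (x : W × W' → H) (w : W) (w' : W') :
    run R₁ R₂ (l.map (liftLeft W')) x (w, w') = run R₁ R₂ l (fun v => x (v, w')) w := by
  induction l generalizing x with
  | nil => rfl
  | cons g l ih =>
    rw [List.map_cons, run_cons, ih, run_cons]
    simp only [apply_liftLeft]

lemma run_map_liftRight (l : List (OracleGate W')) (x : W × W' → H) (w : W) (w' : W') :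
    run R₁ R₂ (l.map (liftRight W)) x (w, w') = run R₁ R₂ l (fun v => x (w, v)) w' := by
  induction l generalizing x with
  | nil => rfl
  | cons g l ih =>
    rw [List.map_cons, run_cons, ih, run_cons]
    simp only [apply_liftRight]

/-- The inverse circuit, when both oracles are involutions. -/
def invList (l : List (OracleGate W)) : List (OracleGate W) := l.reverse.map inv

lemma run_invList_run (h₁ : IsReflection R₁) (h₂ : IsReflection R₂) (l : List (OracleGate W))
    (x : W → H) : run R₁ R₂ (invList l) (run R₁ R₂ l x) = x := by
  induction l generalizing x with
  | nil => rfl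
  | cons g l ih =>
    simp only [invList, List.reverse_cons, List.map_append, run_append, run_cons] at ih ⊢
    rw [ih]
    exact apply_inv_apply h₁ h₂ g x

lemma inner_run (h₁ : IsReflection R₁) (h₂ : IsReflection R₂) (l : List (OracleGate W))
    (x y : W → H) :
    ∑ w, inner ℂ (run R₁ R₂ l x w) (y w) = ∑ w, inner ℂ (x w) (run R₁ R₂ (invList l) y w) := by
  induction l generalizing x y with
  | nil => rfl
  | cons g l ih =>
    rw [run_cons, ih, inner_apply h₁ h₂]
    simp [invList]

lemma sum_norm_sq_run (h₁ : IsReflection R₁) (h₂ : IsReflection R₂) (l : List (OracleGate W))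
    (x : W → H) : ∑ w, ‖run R₁ R₂ l x w‖ ^ 2 = ∑ w, ‖x w‖ ^ 2 := by
  have h := inner_run h₁ h₂ l x (run R₁ R₂ l x)
  rw [run_invList_run h₁ h₂] at h
  simp only [inner_self_eq_norm_sq_to_K] at h
  exact_mod_cast h

/-- Two circuits on separate registers, started on basis states of both. -/
lemma run_liftLeft_append_liftRight (l : List (OracleGate W)) (l' : List (OracleGate W'))
    (i : W) (i' : W') (ψ : H) (w : W) (w' : W') :
    run R₁ R₂ (l.map (liftLeft W') ++ l'.map (liftRight W))
        (fun v => if v = (i, i') then ψ else 0) (w, w') =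
      run R₁ R₂ l'
        (fun v' => if v' = i' then run R₁ R₂ l (fun v => if v = i then ψ else 0) w else 0) w' := by
  rw [run_append, run_map_liftRight]
  congr 1
  ext v
  rw [run_map_liftLeft]
  by_cases hv : v = i'
  · simp only [Prod.mk.injEq, hv, and_true, if_true]
  · simp only [Prod.mk.injEq, hv, and_false, if_false]
    exact congrFun (run_zero l) w

/-- Number of oracle applications in a circuit. -/
def costList (l : List (OracleGate W)) : ℕ := (l.map cost).sum

@[simp] lemma costList_nil : costList ([] : List (OracleGate W)) = 0 := rfl

@[simp] lemma costList_cons (g : OracleGate W) (l : List (OracleGate W)) :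
    costList (g :: l) = g.cost + costList l := by simp [costList]

@[simp] lemma costList_append (l l' : List (OracleGate W)) :
    costList (l ++ l') = costList l + costList l' := by simp [costList]

@[simp] lemma costList_map_liftLeft (l : List (OracleGate W)) :
    costList (l.map (liftLeft W')) = costList l := by
  induction l with
  | nil => rfl
  | cons g l ih => simp [ih]

@[simp] lemma costList_map_liftRight (l : List (OracleGate W')) :
    costList (l.map (liftRight W)) = costList l := by
  induction l with
  | nil => rfl
  | cons g l ih => simp [ih]

@[simp] lemma costList_invList (l : List (OracleGate W)) : costList (invList l) = costList l := by
  induction l with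
  | nil => rfl
  | cons g l ih =>
    have : invList (g :: l) = invList l ++ [g.inv] := by simp [invList]
    rw [this]
    simp [ih, add_comm]

lemma run_mem {V : Submodule ℂ H} (h₁ : ∀ v ∈ V, R₁ v ∈ V) (h₂ : ∀ v ∈ V, R₂ v ∈ V)
    (l : List (OracleGate W)) (x : W → H) (hx : ∀ w, x w ∈ V) (w : W) :
    run R₁ R₂ l x w ∈ V := by
  induction l generalizing x with
  | nil => exact hx w
  | cons g l ih =>
    rw [run_cons]
    refine ih _ fun w => ?_
    cases g with
    | work U => exact V.sum_mem fun v _ => V.smul_mem _ (hx v)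
    | queryFst S => simp only [apply]; split_ifs; exacts [h₁ _ (hx w), hx w]
    | querySnd S => simp only [apply]; split_ifs; exacts [h₂ _ (hx w), hx w]

end OracleGate

namespace QueryAlgorithm

open OracleGate

variable {H : Type*} [NormedAddCommGroup H] [InnerProductSpace ℂ H] {R₁ R₂ : H →L[ℂ] H}

lemma finalState_eq_run (A : QueryAlgorithm) (ψ : H) :
    A.finalState R₁ R₂ ψ = run R₁ R₂ A.gates (A.initState ψ) := rfl

lemma finalState_add (A : QueryAlgorithm) (φ ψ : H) :
    A.finalState R₁ R₂ (φ + ψ) = A.finalState R₁ R₂ φ + A.finalState R₁ R₂ ψ := by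
  simp only [finalState_eq_run, ← run_add]
  congr 1
  ext w
  simp only [initState, Pi.add_apply]
  split_ifs <;> simp

lemma finalState_smul (A : QueryAlgorithm) (c : ℂ) (ψ : H) :
    A.finalState R₁ R₂ (c • ψ) = c • A.finalState R₁ R₂ ψ := by
  simp only [finalState_eq_run, ← run_smul]
  congr 1
  ext w
  simp only [initState, Pi.smul_apply]
  split_ifs <;> simp

lemma sum_norm_sq_finalState (h₁ : IsReflection R₁) (h₂ : IsReflection R₂) (A : QueryAlgorithm)
    (ψ : H) : ∑ w, ‖A.finalState R₁ R₂ ψ w‖ ^ 2 = ‖ψ‖ ^ 2 := by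
  rw [finalState_eq_run, sum_norm_sq_run h₁ h₂, Finset.sum_eq_single A.init]
  · simp [initState]
  · intro w _ hw; simp [initState, hw]
  · simp

lemma finalState_mem {V : Submodule ℂ H} (h₁ : ∀ v ∈ V, R₁ v ∈ V) (h₂ : ∀ v ∈ V, R₂ v ∈ V)
    (A : QueryAlgorithm) {ψ : H} (hψ : ψ ∈ V) (w : A.Work) : A.finalState R₁ R₂ ψ w ∈ V := by
  refine run_mem h₁ h₂ _ _ (fun w => ?_) w
  simp only [initState]
  split_ifs
  exacts [hψ, V.zero_mem]

/-! ### Composition of algorithms -/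

/-- Run `A`, then `B` on the system that `A` leaves, with a workspace of its own. The output is
that of `A`. -/
def seq (A B : QueryAlgorithm) : QueryAlgorithm where
  Work := A.Work × B.Work
  init := (A.init, B.init)
  gates := A.gates.map (liftLeft B.Work) ++ B.gates.map (liftRight A.Work)
  output w := A.output w.1

lemma queries_seq (A B : QueryAlgorithm) : (A.seq B).queries = A.queries + B.queries := by
  change costList (A.gates.map (liftLeft B.Work) ++ B.gates.map (liftRight A.Work)) =
    costList A.gates + costList B.gates
  simp

lemma finalState_seq (A B : QueryAlgorithm) (ψ : H) (w : A.Work) (w' : B.Work) :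
    (A.seq B).finalState R₁ R₂ ψ (w, w') =
      B.finalState R₁ R₂ (A.finalState R₁ R₂ ψ w) w' :=
  run_liftLeft_append_liftRight A.gates B.gates A.init B.init ψ w w'

/-- The algorithm without gates, on a trivial workspace. -/
def trivial : QueryAlgorithm where
  Work := Unit
  init := ()
  gates := []
  output _ := 0

/-- `n` successive runs of `A` on the same system, each with a workspace of its own. -/
def power (A : QueryAlgorithm) : ℕ → QueryAlgorithm
  | 0 => trivial
  | n + 1 => (A.power n).seq A

lemma queries_power (A : QueryAlgorithm) (n : ℕ) : (A.power n).queries = n * A.queries := by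
  induction n with
  | zero => rw [zero_mul]; rfl
  | succ n ih => rw [power, queries_seq, ih]; ring

/-- The outcomes of the `n` runs that are combined in `A.power n`. -/
def outcomes (A : QueryAlgorithm) : (n : ℕ) → (A.power n).Work → List A.Work
  | 0, _ => []
  | n + 1, w => w.2 :: A.outcomes n w.1

lemma length_outcomes (A : QueryAlgorithm) (n : ℕ) (w : (A.power n).Work) :
    (A.outcomes n w).length = n := by
  induction n with
  | zero => rfl
  | succ n ih => simp [outcomes, ih]

lemma sum_work_seq {α : Type*} [AddCommMonoid α] (A B : QueryAlgorithm)
    (f : (A.seq B).Work → α) : ∑ w, f w = ∑ w : A.Work, ∑ w' : B.Work, f (w, w') :=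
  Fintype.sum_prod_type f

lemma probOutput_seq (h₁ : IsReflection R₁) (h₂ : IsReflection R₂) (A B : QueryAlgorithm)
    (ψ : H) (E : ℝ → Prop) :
    (A.seq B).probOutput R₁ R₂ ψ E = A.probOutput R₁ R₂ ψ E := by
  classical
  simp only [probOutput, Finset.sum_filter]
  rw [sum_work_seq]
  refine Finset.sum_congr rfl fun w _ => ?_
  have : ∀ w', (A.seq B).output (w, w') = A.output w := fun _ => rfl
  simp only [this, finalState_seq]
  split_ifs
  · exact sum_norm_sq_finalState h₁ h₂ B _
  · simp

/-! ### Coherent evaluation of the output -/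

/-- The permutation matrix of `(w, o) ↦ (w, swap o₀ (f w) o)`, which writes `f w` into a second
register that holds `o₀`. -/
def writeMatrix {W O : Type} [DecidableEq W] [DecidableEq O] (o₀ : O) (f : W → O) :
    Matrix (W × O) (W × O) ℂ :=
  fun a b => if a.1 = b.1 ∧ Equiv.swap o₀ (f a.1) a.2 = b.2 then 1 else 0

lemma writeMatrix_mem {W O : Type} [Fintype W] [Fintype O] [DecidableEq W] [DecidableEq O]
    (o₀ : O) (f : W → O) : writeMatrix o₀ f ∈ Matrix.unitaryGroup (W × O) ℂ := by
  rw [Matrix.mem_unitaryGroup_iff]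
  ext ⟨w, o⟩ ⟨v, u⟩
  rw [Matrix.mul_apply, Fintype.sum_prod_type]
  by_cases h : w = v
  · subst h
    simp [writeMatrix, Matrix.star_apply, ite_and, Matrix.one_apply, apply_ite, eq_comm]
  · simp [writeMatrix, Matrix.star_apply, ite_and, apply_ite, h]

/-- Run `A`, copy the value of `f` at the workspace state into a fresh register, and undo `A`.
The output is the copied value. -/
noncomputable def coherent (A : QueryAlgorithm) (f : A.Work → ℝ) : QueryAlgorithm where
  Work := A.Work × Set.range f
  init := (A.init, ⟨f A.init, A.init, rfl⟩)
  gates := A.gates.map (liftLeft (Set.range f)) ++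
    [work ⟨writeMatrix ⟨f A.init, A.init, rfl⟩ (Set.rangeFactorization f), writeMatrix_mem _ _⟩] ++
    (invList A.gates).map (liftLeft (Set.range f))
  output w := w.2

lemma queries_coherent (A : QueryAlgorithm) (f : A.Work → ℝ) :
    (A.coherent f).queries = 2 * A.queries := by
  have key : ∀ (O : Type) [Fintype O] [DecidableEq O] (U : Matrix.unitaryGroup (A.Work × O) ℂ),
      costList (A.gates.map (liftLeft O) ++ [work U] ++ (invList A.gates).map (liftLeft O)) =
        2 * costList A.gates := by
    intro O _ _ U
    simp [cost]
    ring
  exact key (Set.range f) _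

lemma finalState_coherent (A : QueryAlgorithm) (f : A.Work → ℝ) (ψ : H) (w : A.Work)
    (o : Set.range f) :
    (A.coherent f).finalState R₁ R₂ ψ (w, o) =
      run R₁ R₂ (invList A.gates)
        (fun v => if Set.rangeFactorization f v = o then A.finalState R₁ R₂ ψ v else 0) w := by
  have key : ∀ (O : Type) [Fintype O] [DecidableEq O] (o₀ o : O) (F : A.Work → O),
      run R₁ R₂ (A.gates.map (liftLeft O) ++ [work ⟨writeMatrix o₀ F, writeMatrix_mem _ _⟩] ++
          (invList A.gates).map (liftLeft O))
          (fun v => if v = (A.init, o₀) then ψ else 0) (w, o) =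
        run R₁ R₂ (invList A.gates)
          (fun v => if F v = o then A.finalState R₁ R₂ ψ v else 0) w := by
    intro O _ _ o₀ o F
    rw [run_append, run_map_liftLeft]
    congr 1
    ext v
    have h : ∀ o', run R₁ R₂ (A.gates.map (liftLeft O))
        (fun v => if v = (A.init, o₀) then ψ else 0) (v, o') =
          if o' = o₀ then A.finalState R₁ R₂ ψ v else 0 := by
      intro o'
      rw [run_map_liftLeft]
      by_cases ho : o' = o₀
      · simp only [Prod.mk.injEq, ho, and_true, if_true]
        rfl
      · simp only [Prod.mk.injEq, ho, and_false, if_false]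
        exact congrFun (run_zero A.gates) v
    have hs : Equiv.swap o₀ (F v) o = o₀ ↔ F v = o := by
      rw [← Equiv.eq_symm_apply, Equiv.symm_swap, Equiv.swap_apply_left, eq_comm]
    simp [apply, writeMatrix, Fintype.sum_prod_type, h, ite_and, hs]
  exact key (Set.range f) _ o (Set.rangeFactorization f)

open Classical in
lemma probOutput_coherent (h₁ : IsReflection R₁) (h₂ : IsReflection R₂) (A : QueryAlgorithm)
    (f : A.Work → ℝ) (ψ : H) (E : ℝ → Prop) :
    (A.coherent f).probOutput R₁ R₂ ψ E =
      ∑ w with E (f w), ‖A.finalState R₁ R₂ ψ w‖ ^ 2 := by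
  have h0 : (A.coherent f).probOutput R₁ R₂ ψ E = ∑ w : A.Work, ∑ o : Set.range f,
      if E o then ‖(A.coherent f).finalState R₁ R₂ ψ (w, o)‖ ^ 2 else 0 := by
    rw [probOutput, Finset.sum_filter]
    refine (Fintype.sum_prod_type (γ := ℝ) _).trans ?_
    rfl
  rw [h0, Finset.sum_comm, Finset.sum_filter]
  have h3 : ∀ o : Set.range f, (∑ w : A.Work,
      if E o then ‖(A.coherent f).finalState R₁ R₂ ψ (w, o)‖ ^ 2 else 0) =
      ∑ w : A.Work, if Set.rangeFactorization f w = o then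
        (if E (f w) then ‖A.finalState R₁ R₂ ψ w‖ ^ 2 else 0) else 0 := by
    intro o
    by_cases ho : E o
    · simp only [ho, if_true, finalState_coherent, sum_norm_sq_run h₁ h₂]
      refine Finset.sum_congr rfl fun w _ => ?_
      by_cases hw : Set.rangeFactorization f w = o
      · have : E (f w) := by rw [← hw] at ho; exact ho
        simp [hw, this]
      · simp [hw]
    · simp only [ho, if_false, Finset.sum_const_zero]
      refine (Finset.sum_eq_zero fun w _ => ?_).symm
      by_cases hw : Set.rangeFactorization f w = o
      · have : ¬ E (f w) := by rw [← hw] at ho; exact ho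
        simp [this]
      · simp [hw]
  rw [Finset.sum_congr rfl fun o _ => h3 o, Finset.sum_comm]
  simp

/-- If `f` takes some value with probability `q`, then undoing the computation leaves the
system in `ψ` with probability at least `q ^ 2`: the amplitude of `ψ ⊗ |init⟩` next to a copied
value is the probability of that value. -/
lemma sq_le_probRestored_coherent (h₁ : IsReflection R₁) (h₂ : IsReflection R₂)
    (A : QueryAlgorithm) (f : A.Work → ℝ) (ψ : H) (c : ℝ) :
    (∑ w with f w = c, ‖A.finalState R₁ R₂ ψ w‖ ^ 2) ^ 2 ≤
      (A.coherent f).probRestored R₁ R₂ ψ := by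
  classical
  by_cases hc : c ∈ Set.range f
  swap
  · rw [Finset.sum_eq_zero]
    · simpa [probRestored] using Finset.sum_nonneg fun _ _ => by positivity
    · intro w hw
      exact absurd ⟨w, (Finset.mem_filter.1 hw).2⟩ hc
  set o : Set.range f := ⟨c, hc⟩
  have hle : ‖inner ℂ ψ ((A.coherent f).finalState R₁ R₂ ψ (A.init, o))‖ ^ 2 ≤
      (A.coherent f).probRestored R₁ R₂ ψ :=
    Finset.single_le_sum
      (f := fun w => ‖inner ℂ ψ ((A.coherent f).finalState R₁ R₂ ψ w)‖ ^ 2)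
      (fun _ _ => by positivity) (Finset.mem_univ (α := (A.coherent f).Work) (A.init, o))
  refine le_trans (le_of_eq ?_) hle
  set y : A.Work → H :=
    fun v => if Set.rangeFactorization f v = o then A.finalState R₁ R₂ ψ v else 0 with hy
  have h := inner_run h₁ h₂ A.gates (A.initState ψ) y
  have hi : ∑ w, inner ℂ (A.initState ψ w) (run R₁ R₂ (invList A.gates) y w) =
      inner ℂ ψ (run R₁ R₂ (invList A.gates) y A.init) := by
    rw [Finset.sum_eq_single A.init]
    · simp [initState]
    · intro w _ hw; simp [initState, hw]
    · simp
  rw [finalState_coherent]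
  have h' : ∑ v, inner ℂ (run R₁ R₂ A.gates (A.initState ψ) v) (y v) =
      ((∑ w with f w = c, ‖A.finalState R₁ R₂ ψ w‖ ^ 2 : ℝ) : ℂ) := by
    rw [Finset.sum_filter]
    push_cast
    refine Finset.sum_congr rfl fun v _ => ?_
    have : Set.rangeFactorization f v = o ↔ f v = c := Subtype.ext_iff
    rw [← finalState_eq_run, hy]
    simp only [this]
    split_ifs
    · rw [inner_self_eq_norm_sq_to_K]; simp
    · simp
  rw [← hi, ← h, h', Complex.norm_real, Real.norm_eq_abs, sq_abs]

end QueryAlgorithm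

/-! ### The plane spanned by the state and its projection -/

section Plane

variable {H : Type*} [NormedAddCommGroup H] [InnerProductSpace ℂ H]

lemma stateReflection_apply (ψ x : H) :
    stateReflection ψ x = x - (2 : ℂ) • (inner ℂ ψ x • ψ) := by
  simp [stateReflection]

lemma projReflection_apply (P : H →L[ℂ] H) (x : H) : projReflection P x = x - (2 : ℂ) • P x := by
  simp [projReflection]

lemma isReflection_stateReflection {ψ : H} (hψ : ‖ψ‖ = 1) : IsReflection (stateReflection ψ) := by
  have h1 : inner ℂ ψ ψ = 1 := by rw [inner_self_eq_norm_sq_to_K, hψ]; simp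
  refine ⟨fun x y => ?_, fun x => ?_⟩
  · simp only [stateReflection_apply, inner_sub_left, inner_sub_right, inner_smul_left,
      inner_smul_right, inner_conj_symm, map_ofNat]
    ring
  · simp only [stateReflection_apply, inner_sub_right, inner_smul_right, h1]
    module

lemma isReflection_projReflection [CompleteSpace H] {P : H →L[ℂ] H} (hP : IsStarProjection P) :
    IsReflection (projReflection P) := by
  have hs := hP.isSelfAdjoint.isSymmetric
  have hi : ∀ x, P (P x) = P x := fun x => congr($(hP.isIdempotentElem) x)
  refine ⟨fun x y => ?_, fun x => ?_⟩
  · have : inner ℂ (P x) y = inner ℂ x (P y) := hs x y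
    simp only [projReflection_apply, inner_sub_left, inner_sub_right, inner_smul_left,
      inner_smul_right, map_ofNat, this]
  · simp only [projReflection_apply, map_sub, map_smul, hi]
    module

/-- The span of the unit vector `ψ` and of `e` is invariant under both operators, and the product
`R₁ R₂` rotates it by the angle `β`. The vector `e` is normed or zero; the latter case is needed
when `ψ` is an eigenvector of `R₂`, where the plane degenerates to a line. -/
structure IsRotationPlane (R₁ R₂ : H →L[ℂ] H) (ψ e : H) (β : ℝ) : Prop where
  norm_eq : ‖ψ‖ = 1
  norm_le : ‖e‖ ≤ 1
  inner_eq : inner ℂ ψ e = 0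
  fst_self : R₁ ψ = -ψ
  fst_orth : R₁ e = e
  snd_self : R₂ ψ = -(Real.cos β : ℂ) • ψ - (Real.sin β : ℂ) • e
  snd_orth : R₂ e = -(Real.sin β : ℂ) • ψ + (Real.cos β : ℂ) • e

lemma exists_isRotationPlane [CompleteSpace H] {ψ : H} {P : H →L[ℂ] H} {p β : ℝ} (hψ : ‖ψ‖ = 1)
    (hP : IsStarProjection P) (hp : p = ‖P ψ‖ ^ 2) (hc : Real.cos β = 2 * p - 1)
    (hs : Real.sin β = 2 * Real.sqrt (p * (1 - p))) (hp1 : p ≤ 1) :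
    ∃ e, IsRotationPlane (stateReflection ψ) (projReflection P) ψ e β := by
  have hi : ∀ x, P (P x) = P x := fun x => congr($(hP.isIdempotentElem) x)
  have hsym : ∀ x y, inner ℂ (P x) y = inner ℂ x (P y) := fun x y =>
    hP.isSelfAdjoint.isSymmetric x y
  have h1 : inner ℂ ψ ψ = 1 := by rw [inner_self_eq_norm_sq_to_K, hψ]; simp
  have hψP : inner ℂ ψ (P ψ) = (p : ℂ) := by
    rw [← hi ψ, ← hsym, inner_self_eq_norm_sq_to_K, hp]; simp
  have hp0 : 0 ≤ p := by rw [hp]; positivity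
  set s := Real.sqrt (p * (1 - p)) with hsdef
  have hs2 : s ^ 2 = p * (1 - p) := Real.sq_sqrt (mul_nonneg hp0 (by linarith))
  set u : H := P ψ - (p : ℂ) • ψ with hu
  have hun : ‖u‖ ^ 2 = s ^ 2 := by
    have : (inner ℂ u u : ℂ) = ((s ^ 2 : ℝ) : ℂ) := by
      have hPP : inner ℂ (P ψ) (P ψ) = (p : ℂ) := by rw [hsym, hi, hψP]
      have hPψ : inner ℂ (P ψ) ψ = (p : ℂ) := by rw [hsym, hψP]
      simp only [hu, inner_sub_left, inner_sub_right, inner_smul_left, inner_smul_right, hPP, hPψ,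
        hψP, h1, hs2, Complex.conj_ofReal]
      push_cast
      ring
    rw [inner_self_eq_norm_sq_to_K] at this
    have h := congrArg Complex.re this
    rwa [← RCLike.ofReal_pow, Complex.ofReal_re] at h
  have hψu : inner ℂ ψ u = 0 := by
    rw [hu, inner_sub_right, inner_smul_right, hψP, h1, mul_one, sub_self]
  have hPψ : P ψ = (p : ℂ) • ψ + u := by rw [hu]; abel
  have hPu : P u = ((s ^ 2 : ℝ) : ℂ) • ψ + ((1 - p : ℝ) : ℂ) • u := by
    rw [hs2, hu, map_sub, map_smul, hi]
    push_cast
    module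
  have hs0 : s = 0 → u = 0 := by
    intro h; rw [h] at hun; simpa using hun
  -- For `s = 0` the junk value of the inverse gives `e = 0`.
  refine ⟨((s⁻¹ : ℝ) : ℂ) • u, hψ, ?_, ?_, ?_, ?_, ?_, ?_⟩
  · have : ‖u‖ = s := by
      exact (pow_left_inj₀ (norm_nonneg u) (Real.sqrt_nonneg _) two_ne_zero).1 hun
    rw [norm_smul, Complex.norm_real, Real.norm_eq_abs, abs_inv, this,
      abs_of_nonneg (Real.sqrt_nonneg _ : 0 ≤ s)]
    exact inv_mul_le_one
  · rw [inner_smul_right, hψu, mul_zero]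
  · rw [stateReflection_apply, h1]; module
  · rw [stateReflection_apply, inner_smul_right, hψu]; simp
  · rw [projReflection_apply, hPψ, hc, hs]
    by_cases h : s = 0
    · rw [hs0 h]; push_cast; module
    · have : (s : ℂ) ≠ 0 := by exact_mod_cast h
      simp only [smul_smul]
      push_cast
      rw [mul_assoc, mul_inv_cancel₀ this]
      module
  · rw [projReflection_apply, map_smul, hPu, hc, hs]
    by_cases h : s = 0
    · rw [hs0 h, h]; simp
    · have : (s : ℂ) ≠ 0 := by exact_mod_cast h
      have h2 : (s : ℂ)⁻¹ * (s : ℂ) ^ 2 = s := by field_simp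
      push_cast
      simp only [smul_add, smul_smul, h2]
      module

namespace IsRotationPlane

variable {R₁ R₂ : H →L[ℂ] H} {ψ e : H} {β : ℝ}

lemma mul_self (h : IsRotationPlane R₁ R₂ ψ e β) :
    R₁ (R₂ ψ) = (Real.cos β : ℂ) • ψ - (Real.sin β : ℂ) • e := by
  rw [h.snd_self, map_sub, map_smul, map_smul, h.fst_self, h.fst_orth]
  module

lemma mul_orth (h : IsRotationPlane R₁ R₂ ψ e β) :
    R₁ (R₂ e) = (Real.sin β : ℂ) • ψ + (Real.cos β : ℂ) • e := by
  rw [h.snd_orth, map_add, map_smul, map_smul, h.fst_self, h.fst_orth]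
  module

lemma iterate_orth (h : IsRotationPlane R₁ R₂ ψ e β) (k : ℕ) :
    (fun x => R₁ (R₂ x))^[k] e = (Real.sin (k * β) : ℂ) • ψ + (Real.cos (k * β) : ℂ) • e := by
  induction k with
  | zero => simp
  | succ k ih =>
    rw [Function.iterate_succ_apply', ih]
    simp only [map_add, map_smul, h.mul_self, h.mul_orth]
    have : ((k + 1 : ℕ) : ℝ) * β = k * β + β := by push_cast; ring
    rw [this, Real.sin_add, Real.cos_add]
    push_cast
    module

/-- The decomposition of `ψ` into eigenvectors of the rotation. For a degenerate plane they
need not be orthogonal; the norm bounds are enough. -/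
lemma exists_eigenvectors (h : IsRotationPlane R₁ R₂ ψ e β) :
    ∃ φ φ' : H, ψ = φ + φ' ∧ ‖φ‖ ^ 2 ≤ 1 / 2 ∧ ‖φ'‖ ^ 2 ≤ 1 / 2 ∧
      R₁ (R₂ φ) = Complex.exp ((β : ℝ) * Complex.I) • φ ∧
      R₁ (R₂ φ') = Complex.exp ((-β : ℝ) * Complex.I) • φ' := by
  have hnorm : ∀ c : ℂ, ‖c‖ = 1 → ‖(1 / 2 : ℂ) • (ψ + c • e)‖ ^ 2 ≤ 1 / 2 := by
    intro c hc
    have h1 : ‖ψ + c • e‖ ^ 2 = ‖ψ‖ ^ 2 + ‖c • e‖ ^ 2 := by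
      simpa [sq] using norm_add_sq_eq_norm_sq_add_norm_sq_of_inner_eq_zero ψ (c • e)
        (𝕜 := ℂ) (by rw [inner_smul_right, h.inner_eq, mul_zero])
    have h2 : ‖e‖ ^ 2 ≤ 1 := pow_le_one₀ (norm_nonneg _) h.norm_le
    rw [norm_smul, mul_pow, h1, norm_smul, hc, h.norm_eq]
    norm_num
    linarith
  refine ⟨(1 / 2 : ℂ) • (ψ + Complex.I • e), (1 / 2 : ℂ) • (ψ + (-Complex.I) • e), by module,
    hnorm _ (by simp), hnorm _ (by simp), ?_, ?_⟩
  · rw [Complex.exp_mul_I, ← Complex.ofReal_cos, ← Complex.ofReal_sin]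
    simp only [map_smul, map_add, h.mul_self, h.mul_orth]
    match_scalars
    · ring
    · linear_combination (-(Complex.sin (β : ℂ)) / 2) * Complex.I_sq
  · rw [Complex.exp_mul_I, ← Complex.ofReal_cos, ← Complex.ofReal_sin, Real.cos_neg, Real.sin_neg]
    simp only [map_smul, map_add, h.mul_self, h.mul_orth]
    push_cast
    match_scalars
    · ring
    · linear_combination (-(Complex.sin (β : ℂ)) / 2) * Complex.I_sq

lemma fst_mem (h : IsRotationPlane R₁ R₂ ψ e β) :
    ∀ v ∈ Submodule.span ℂ {ψ, e}, R₁ v ∈ Submodule.span ℂ {ψ, e} := by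
  intro v hv
  obtain ⟨a, b, rfl⟩ := Submodule.mem_span_pair.1 hv
  refine Submodule.mem_span_pair.2 ⟨-a, b, ?_⟩
  rw [map_add, map_smul, map_smul, h.fst_self, h.fst_orth]
  module

lemma snd_mem (h : IsRotationPlane R₁ R₂ ψ e β) :
    ∀ v ∈ Submodule.span ℂ {ψ, e}, R₂ v ∈ Submodule.span ℂ {ψ, e} := by
  intro v hv
  obtain ⟨a, b, rfl⟩ := Submodule.mem_span_pair.1 hv
  refine Submodule.mem_span_pair.2 ⟨-(a * Real.cos β) - b * Real.sin β,
    -(a * Real.sin β) + b * Real.cos β, ?_⟩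
  rw [map_add, map_smul, map_smul, h.snd_self, h.snd_orth]
  module

end IsRotationPlane

end Plane

/-! ### Phase estimation -/

section Unitaries

/-- Every unit vector is a column of some unitary matrix. -/
lemma exists_unitary_column {ι : Type} [Fintype ι] [DecidableEq ι] (i₀ : ι) (a : ι → ℂ)
    (ha : ∑ i, ‖a i‖ ^ 2 = 1) :
    ∃ U : Matrix.unitaryGroup ι ℂ, ∀ i, (U : Matrix ι ι ℂ) i i₀ = a i := by
  let v : ι → EuclideanSpace ℂ ι := fun _ => WithLp.toLp 2 a
  have hv : Orthonormal ℂ (Set.domRestrict {i₀} v) := by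
    refine ⟨fun i => ?_, fun i j hij => absurd (Subsingleton.elim i j) hij⟩
    have : ‖v i₀‖ = 1 := by
      rw [EuclideanSpace.norm_eq, Real.sqrt_eq_one]; exact ha
    exact this
  obtain ⟨b, hb⟩ := hv.exists_orthonormalBasis_extension_of_card_eq (by simp)
  refine ⟨⟨_, (EuclideanSpace.basisFun ι ℂ).toMatrix_orthonormalBasis_mem_unitary b⟩, fun i => ?_⟩
  simp [Module.Basis.toMatrix_apply, hb i₀ rfl, v]

lemma sum_norm_sq_unitary {ι : Type} [Fintype ι] [DecidableEq ι] (U : Matrix.unitaryGroup ι ℂ)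
    (u : ι → ℂ) : ∑ j, ‖∑ k, (U : Matrix ι ι ℂ) j k * u k‖ ^ 2 = ∑ k, ‖u k‖ ^ 2 := by
  have h : IsReflection (1 : ℂ →L[ℂ] ℂ) := ⟨fun _ _ => rfl, fun _ => rfl⟩
  simpa [OracleGate.apply] using OracleGate.sum_norm_sq_run h h [.work U] u

/-- The matrix of the inverse Fourier transform on `ℤ / K`. -/
noncomputable def fourierMatrix (K : ℕ) : Matrix (Fin K) (Fin K) ℂ :=
  fun j k => ((Real.sqrt K)⁻¹ : ℝ) *
    Complex.exp ((-(2 * Real.pi * j / K) : ℝ) * Complex.I) ^ (k : ℕ)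

lemma fourierMatrix_mem (K : ℕ) [NeZero K] :
    fourierMatrix K ∈ Matrix.unitaryGroup (Fin K) ℂ := by
  rw [Matrix.mem_unitaryGroup_iff']
  ext k l
  have hK : (K : ℂ) ≠ 0 := Nat.cast_ne_zero.2 (NeZero.ne K)
  set ζ := Complex.exp (2 * Real.pi * Complex.I / K) with hζ
  have hprim : IsPrimitiveRoot ζ K := Complex.isPrimitiveRoot_exp K (NeZero.ne K)
  have hζ0 : ζ ≠ 0 := Complex.exp_ne_zero _
  have hω : ∀ j : Fin K, Complex.exp ((-(2 * Real.pi * j / K) : ℝ) * Complex.I) =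
      (ζ⁻¹) ^ (j : ℕ) := by
    intro j
    rw [hζ, ← Complex.exp_neg, ← Complex.exp_nat_mul]
    congr 1
    push_cast
    ring
  have hconj : (starRingEnd ℂ) ζ = ζ⁻¹ := by
    rw [hζ, ← Complex.exp_conj, ← Complex.exp_neg]
    congr 1
    simp [div_eq_mul_inv, Complex.conj_ofNat]
  set r := ζ ^ (k : ℕ) * (ζ⁻¹) ^ (l : ℕ) with hr
  have hterm : ∀ j : Fin K, star (fourierMatrix K j k) * fourierMatrix K j l =
      (K : ℂ)⁻¹ * r ^ (j : ℕ) := by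
    intro j
    have hs : (((Real.sqrt K)⁻¹ : ℝ) : ℂ) * (((Real.sqrt K)⁻¹ : ℝ) : ℂ) = (K : ℂ)⁻¹ := by
      rw [← Complex.ofReal_mul, ← mul_inv, Real.mul_self_sqrt (by positivity)]
      push_cast; rfl
    simp only [fourierMatrix, hω, Complex.star_def, map_mul, map_pow, map_inv₀, hconj,
      Complex.conj_ofReal, inv_inv, hr, ← hs]
    ring
  rw [Matrix.mul_apply]
  simp only [Matrix.star_apply, hterm]
  rw [← Finset.mul_sum, Fin.sum_univ_eq_sum_range (fun j => r ^ j) K]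
  by_cases hkl : k = l
  · subst hkl
    have : r = 1 := by rw [hr, inv_pow, mul_inv_cancel₀ (pow_ne_zero _ hζ0)]
    simp [this, hK]
  · have hr1 : r ≠ 1 := by
      intro h
      rw [hr, inv_pow, mul_inv_eq_one₀ (pow_ne_zero _ hζ0)] at h
      exact hkl (Fin.ext (hprim.pow_inj k.2 l.2 h))
    have hrK : r ^ K = 1 := by
      rw [hr, mul_pow, inv_pow, inv_pow, ← pow_mul, ← pow_mul, mul_comm (k : ℕ), mul_comm (l : ℕ),
        pow_mul, pow_mul, hprim.pow_eq_one]
      simp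
    rw [geom_sum_eq hr1, hrK]
    simp [hkl]

end Unitaries

section Window

/-- The amplitudes `√(2/K) sin(π(k+1)/K)` of the index register in phase estimation. -/
noncomputable def sineWindow (K : ℕ) (k : ℕ) : ℝ :=
  Real.sqrt (2 / K) * Real.sin (Real.pi * (k + 1) / K)

lemma sum_sineWindow_sq {K : ℕ} (hK : 2 ≤ K) : ∑ k : Fin K, sineWindow K k ^ 2 = 1 := by
  have hK0 : (K : ℝ) ≠ 0 := by positivity
  have hcos : ∑ k ∈ Finset.range K, Real.cos (2 * (Real.pi * (k + 1) / K)) = 0 := by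
    have h := (Complex.isPrimitiveRoot_exp K (by lia)).geom_sum_eq_zero (by lia : 1 < K)
    have h' := congrArg (fun z => (z * Complex.exp (2 * Real.pi * Complex.I / K)).re) h
    simp only [Finset.sum_mul, zero_mul, Complex.zero_re, Complex.re_sum, ← Complex.exp_nat_mul,
      ← Complex.exp_add] at h'
    rw [← h']
    refine Finset.sum_congr rfl fun k _ => ?_
    rw [← Complex.exp_ofReal_mul_I_re]
    congr 2
    push_cast
    ring
  have hterm : ∀ k : ℕ, sineWindow K k ^ 2 =
      1 / K - Real.cos (2 * (Real.pi * (k + 1) / K)) / K := by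
    intro k
    rw [sineWindow, mul_pow, Real.sq_sqrt (by positivity), Real.sin_sq_eq_half_sub]
    field_simp
  rw [Fin.sum_univ_eq_sum_range (fun k => sineWindow K k ^ 2) K]
  simp only [hterm, Finset.sum_sub_distrib, ← Finset.sum_div, hcos]
  simp [hK0]

/-- The amplitude of outcome `j` in phase estimation of the eigenvalue `exp (iβ)`. -/
noncomputable def phaseAmplitude (K : ℕ) (β : ℝ) (j : Fin K) : ℂ :=
  ∑ k : Fin K, fourierMatrix K j k * (sineWindow K k * Complex.exp (β * Complex.I) ^ (k : ℕ))

lemma sum_norm_sq_phaseAmplitude {K : ℕ} (hK : 2 ≤ K) (β : ℝ) :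
    ∑ j, ‖phaseAmplitude K β j‖ ^ 2 = 1 := by
  have : NeZero K := ⟨by lia⟩
  rw [← sum_sineWindow_sq hK]
  refine (sum_norm_sq_unitary ⟨_, fourierMatrix_mem K⟩ _).trans ?_
  refine Finset.sum_congr rfl fun k _ => ?_
  rw [norm_mul, norm_pow, Complex.norm_exp_ofReal_mul_I, one_pow, mul_one, Complex.norm_real,
    Real.norm_eq_abs, sq_abs]

/-- The mean squared error of phase estimation. Multiplying the outcome amplitudes by
`1 - exp (i(β - 2πj/K))` amounts to replacing the window by its difference sequence, as the window
vanishes at the last index; so by Parseval the error is the Dirichlet energy of the window. -/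
lemma sum_norm_sq_phaseAmplitude_mul_sin_sq_le {K : ℕ} (hK : 2 ≤ K) (β : ℝ) :
    ∑ j : Fin K, ‖phaseAmplitude K β j‖ ^ 2 * Real.sin ((β - 2 * Real.pi * j / K) / 2) ^ 2 ≤
      5 / K ^ 2 := by
  have : NeZero K := ⟨by lia⟩
  have hK0 : (0 : ℝ) < K := by positivity
  set μ := Complex.exp (β * Complex.I)
  set d : ℕ → ℝ := fun k => Real.sqrt (2 / K) * Real.sin (Real.pi * k / K) with hd
  have hd1 : ∀ k, d (k + 1) = sineWindow K k := fun k => by simp [hd, sineWindow]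
  have hd0 : d 0 = 0 := by simp [hd]
  have hdK : d K = 0 := by simp [hd, hK0.ne']
  have hkey : ∀ j : Fin K,
      ‖phaseAmplitude K β j‖ ^ 2 * Real.sin ((β - 2 * Real.pi * j / K) / 2) ^ 2 =
      ‖∑ k : Fin K, fourierMatrix K j k * ((sineWindow K k - d k : ℝ) * μ ^ (k : ℕ))‖ ^ 2 / 4 := by
    intro j
    set ν := Complex.exp ((-(2 * Real.pi * j / K) : ℝ) * Complex.I)
    have hshift : (μ * ν) * phaseAmplitude K β j =
        ∑ k : Fin K, fourierMatrix K j k * (d k * μ ^ (k : ℕ)) := by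
      have h1 := Fin.sum_univ_eq_sum_range
        (fun k => (((Real.sqrt K)⁻¹ : ℝ) : ℂ) * ν ^ k * (d k * μ ^ k)) K
      have h2 := Fin.sum_univ_eq_sum_range
        (fun k => (((Real.sqrt K)⁻¹ : ℝ) : ℂ) * ν ^ k * (sineWindow K k * μ ^ k)) K
      simp only [phaseAmplitude, fourierMatrix] at *
      rw [h1, h2]
      have h3 := Finset.sum_range_succ
        (fun k => (((Real.sqrt K)⁻¹ : ℝ) : ℂ) * ν ^ k * (d k * μ ^ k)) K
      rw [Finset.sum_range_succ', hdK, hd0] at h3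
      simp only [Complex.ofReal_zero, zero_mul, mul_zero, add_zero] at h3
      rw [← h3, Finset.mul_sum]
      refine Finset.sum_congr rfl fun k _ => ?_
      rw [hd1]
      ring
    have hdiff : ∑ k : Fin K, fourierMatrix K j k * ((sineWindow K k - d k : ℝ) * μ ^ (k : ℕ)) =
        (1 - μ * ν) * phaseAmplitude K β j := by
      rw [sub_mul, hshift, one_mul, phaseAmplitude, ← Finset.sum_sub_distrib]
      refine Finset.sum_congr rfl fun k _ => ?_
      push_cast
      ring
    have hμν : μ * ν = Complex.exp (Complex.I * (β - 2 * Real.pi * j / K : ℝ)) := by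
      rw [← Complex.exp_add]
      congr 1
      push_cast
      ring
    rw [hdiff, norm_mul, mul_pow, norm_sub_rev, hμν, Complex.norm_exp_I_mul_ofReal_sub_one,
      norm_mul, mul_pow, Real.norm_eq_abs, Real.norm_eq_abs, sq_abs, sq_abs]
    ring
  have hstep : ∀ k : ℕ, (sineWindow K k - d k) ^ 2 ≤ 2 / K * (Real.pi / K) ^ 2 := by
    intro k
    have h1 : |Real.sin (Real.pi * (k + 1) / K) - Real.sin (Real.pi * k / K)| ≤ Real.pi / K := by
      refine (Real.abs_sin_sub_sin_le _ _).trans (le_of_eq ?_)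
      rw [← sub_div, ← mul_sub, add_sub_cancel_left, mul_one, abs_of_pos (by positivity)]
    rw [sineWindow, hd, ← mul_sub, mul_pow, Real.sq_sqrt (by positivity)]
    gcongr ?_ * ?_
    exact sq_le_sq' (abs_le.1 h1).1 (abs_le.1 h1).2
  simp only [hkey]
  rw [← Finset.sum_div, sum_norm_sq_unitary ⟨_, fourierMatrix_mem K⟩]
  have hsum : ∑ k : Fin K, ‖((sineWindow K k - d k : ℝ) : ℂ) * μ ^ (k : ℕ)‖ ^ 2 ≤
      ∑ _k : Fin K, 2 / K * (Real.pi / K) ^ 2 := by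
    refine Finset.sum_le_sum fun k _ => ?_
    rw [norm_mul, norm_pow, Complex.norm_exp_ofReal_mul_I, one_pow, mul_one, Complex.norm_real,
      Real.norm_eq_abs, sq_abs]
    exact hstep k
  rw [Finset.sum_const, Finset.card_univ, Fintype.card_fin, nsmul_eq_mul] at hsum
  refine (div_le_div_of_nonneg_right hsum (by norm_num)).trans ?_
  have hpi : Real.pi ^ 2 ≤ 10 := by
    nlinarith [Real.pi_lt_d2, Real.pi_pos]
  rw [show (K : ℝ) * (2 / K * (Real.pi / K) ^ 2) / 4 = Real.pi ^ 2 / 2 / K ^ 2 by field_simp; ring]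
  gcongr
  linarith

/-- The estimate of `(1 + cos β) / 2` that belongs to outcome `j` of phase estimation. -/
noncomputable def phaseEstimate (K : ℕ) (j : Fin K) : ℝ :=
  (1 + Real.cos (2 * Real.pi * j / K)) / 2

lemma abs_half_one_add_cos_sub_lt {θ β s : ℝ} (h : |Real.sin ((β - θ) / 2)| < s) :
    |(1 + Real.cos θ) / 2 - (1 + Real.cos β) / 2| < |Real.sin β| * s + s ^ 2 := by
  set x := (β - θ) / 2 with hx
  have h1 : (1 + Real.cos θ) / 2 - (1 + Real.cos β) / 2 = Real.sin x * Real.sin (β - x) := by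
    have h2 := Real.cos_sub_cos θ β
    have h3 : (θ + β) / 2 = β - x := by rw [hx]; ring
    have h4 : (θ - β) / 2 = -x := by rw [hx]; ring
    rw [h3, h4, Real.sin_neg] at h2
    linarith
  have h5 : |Real.sin (β - x)| ≤ |Real.sin β| + |Real.sin x| := by
    rw [Real.sin_sub]
    refine (abs_sub _ _).trans (add_le_add ?_ ?_)
    · rw [abs_mul]; exact mul_le_of_le_one_right (abs_nonneg _) (Real.abs_cos_le_one _)
    · rw [abs_mul]; exact mul_le_of_le_one_left (abs_nonneg _) (Real.abs_cos_le_one _)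
  rw [h1, abs_mul]
  have h6 := abs_nonneg (Real.sin x)
  have h7 := abs_nonneg (Real.sin β)
  calc |Real.sin x| * |Real.sin (β - x)| ≤ |Real.sin x| * (|Real.sin β| + |Real.sin x|) := by
        gcongr
    _ < |Real.sin β| * s + s ^ 2 := by nlinarith

lemma sum_norm_sq_phaseAmplitude_bad_le {K : ℕ} (hK : 2 ≤ K) (β : ℝ) {s : ℝ} (hs : 0 < s) :
    ∑ j : Fin K with ¬ |phaseEstimate K j - (1 + Real.cos β) / 2| < |Real.sin β| * s + s ^ 2,
      ‖phaseAmplitude K β j‖ ^ 2 ≤ 5 / (K ^ 2 * s ^ 2) := by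
  rw [← div_div, le_div_iff₀ (by positivity)]
  refine le_trans ?_ (sum_norm_sq_phaseAmplitude_mul_sin_sq_le hK β)
  rw [Finset.sum_filter, Finset.sum_mul]
  refine Finset.sum_le_sum fun j _ => ?_
  split_ifs with h
  · rw [zero_mul]; positivity
  · gcongr ?_ * ?_
    rw [← sq_abs (Real.sin _)]
    gcongr
    by_contra h'
    exact h (abs_half_one_add_cos_sub_lt (not_le.1 h'))

end Window

section Circuit

open OracleGate

/-- The circuit that applies `R₁ R₂` to the system `min (κ w) n` times when the workspace is in the
basis state `w`. -/
def walkGates {W : Type} [Fintype W] [DecidableEq W] (κ : W → ℕ) : ℕ → List (OracleGate W)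
  | 0 => []
  | n + 1 => walkGates κ n ++
      [querySnd (Finset.univ.filter fun w => n < κ w),
        queryFst (Finset.univ.filter fun w => n < κ w)]

lemma costList_walkGates {W : Type} [Fintype W] [DecidableEq W] (κ : W → ℕ) (n : ℕ) :
    costList (walkGates κ n) = 2 * n := by
  induction n with
  | zero => rfl
  | succ n ih => simp [walkGates, ih, cost]; ring

variable {H : Type*} [NormedAddCommGroup H] [InnerProductSpace ℂ H] {R₁ R₂ : H →L[ℂ] H}

lemma run_walkGates {W : Type} [Fintype W] [DecidableEq W] (κ : W → ℕ) (n : ℕ) (x : W → H)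
    (w : W) : run R₁ R₂ (walkGates κ n) x w = (fun v => R₁ (R₂ v))^[min (κ w) n] (x w) := by
  induction n with
  | zero => simp [walkGates]
  | succ n ih =>
    rw [walkGates, run_append]
    by_cases h : n < κ w
    · have h1 : min (κ w) (n + 1) = n + 1 := by lia
      rw [min_eq_right h.le] at ih
      rw [h1, Function.iterate_succ_apply', ← ih]
      simp [apply, h]
    · have h1 : min (κ w) (n + 1) = min (κ w) n := by lia
      simp [apply, h, ih, h1]

/-- Phase estimation for `R₁ R₂` on an index register `Fin K`, with the first column of `U` as
amplitudes of the register. The outcome itself is what matters; the output is set to `0`. -/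
noncomputable def phaseEstimation (K : ℕ) [NeZero K] (U : Matrix.unitaryGroup (Fin K) ℂ) :
    QueryAlgorithm where
  Work := Fin K
  init := 0
  gates := work U :: walkGates Fin.val K ++ [work ⟨fourierMatrix K, fourierMatrix_mem K⟩]
  output _ := 0

lemma queries_phaseEstimation (K : ℕ) [NeZero K] (U : Matrix.unitaryGroup (Fin K) ℂ) :
    (phaseEstimation K U).queries = 2 * K := by
  have : costList (work U :: walkGates Fin.val K ++
      [work ⟨fourierMatrix K, fourierMatrix_mem K⟩]) = 2 * K := by
    simp [costList_walkGates, cost]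
  exact this

lemma iterate_eigenvector {φ : H} {μ : ℂ} (h : R₁ (R₂ φ) = μ • φ) (c : ℂ) (k : ℕ) :
    (fun v => R₁ (R₂ v))^[k] (c • φ) = (c * μ ^ k) • φ := by
  induction k with
  | zero => simp
  | succ k ih => rw [Function.iterate_succ_apply', ih, map_smul, map_smul, h]; module

lemma finalState_phaseEstimation (K : ℕ) [NeZero K] {U : Matrix.unitaryGroup (Fin K) ℂ}
    (hU : ∀ k, (U : Matrix (Fin K) (Fin K) ℂ) k 0 = sineWindow K k) {φ : H} {β : ℝ}
    (h : R₁ (R₂ φ) = Complex.exp (β * Complex.I) • φ) (j : Fin K) :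
    (phaseEstimation K U).finalState R₁ R₂ φ j = phaseAmplitude K β j • φ := by
  have key : run R₁ R₂ (work U :: walkGates Fin.val K ++
      [work ⟨fourierMatrix K, fourierMatrix_mem K⟩]) (fun k => if k = 0 then φ else 0) j =
      phaseAmplitude K β j • φ := by
    simp only [List.cons_append, run_cons, run_append, run_nil]
    simp only [apply, run_walkGates, smul_ite, smul_zero, Finset.sum_ite_eq', Finset.mem_univ,
      if_true, hU, phaseAmplitude, Finset.sum_smul]
    refine Finset.sum_congr rfl fun k _ => ?_
    rw [min_eq_left k.2.le, iterate_eigenvector h, smul_smul]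
  exact key

end Circuit

/-! ### Median amplification -/

lemma exists_median (l : List ℝ) :
    ∃ v, l.length ≤ 2 * l.countP (· ≤ v) ∧ l.length ≤ 2 * l.countP (v ≤ ·) := by
  classical
  by_cases hl : l = []
  · exact ⟨0, by simp [hl]⟩
  -- The median is the least entry `v` such that at least half of the entries are at most `v`.
  set T := l.toFinset.filter fun v => l.length ≤ 2 * l.countP (· ≤ v) with hT
  have hne : l.toFinset.Nonempty := List.toFinset_nonempty_iff l |>.2 hl
  have hTne : T.Nonempty := by
    obtain ⟨v, hv, hmax⟩ := l.toFinset.exists_max_image id hne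
    refine ⟨v, Finset.mem_filter.2 ⟨hv, ?_⟩⟩
    have : l.countP (· ≤ v) = l.length :=
      List.countP_eq_length.2 fun a ha => by simpa using hmax a (List.mem_toFinset.2 ha)
    lia
  obtain ⟨v, hv, hmin⟩ := T.exists_min_image id hTne
  refine ⟨v, (Finset.mem_filter.1 hv).2, ?_⟩
  by_contra hlt
  have hadd := List.length_eq_countP_add_countP (fun x => decide (v ≤ x)) (l := l)
  set S := l.toFinset.filter fun x => x < v with hS
  have hSne : S.Nonempty := by
    rw [Finset.nonempty_iff_ne_empty]
    intro hS0
    have : l.countP (v ≤ ·) = l.length := List.countP_eq_length.2 fun a ha => by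
      have := Finset.filter_eq_empty_iff.1 hS0 (List.mem_toFinset.2 ha)
      simpa using this
    lia
  obtain ⟨u, hu, hmax⟩ := S.exists_max_image id hSne
  have hu' := Finset.mem_filter.1 hu
  have hle : l.countP (fun a => ¬ decide (v ≤ a) = true) ≤ l.countP (· ≤ u) := by
    refine List.countP_mono_left fun a ha hav => ?_
    have : a < v := by simpa using hav
    simpa using hmax a (Finset.mem_filter.2 ⟨List.mem_toFinset.2 ha, this⟩)
  have huT : u ∈ T := Finset.mem_filter.2 ⟨hu'.1, by lia⟩
  exact absurd (hmin u huT) (not_le.2 hu'.2)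

/-- A median of a list of real numbers. -/
noncomputable def median (l : List ℝ) : ℝ := (exists_median l).choose

lemma abs_median_sub_lt {l : List ℝ} {p ε : ℝ}
    (h : 2 * l.countP (fun x => ¬ |x - p| < ε) < l.length) : |median l - p| < ε := by
  obtain ⟨h1, h2⟩ := (exists_median l).choose_spec
  change _ ≤ 2 * l.countP (· ≤ median l) at h1
  change _ ≤ 2 * l.countP (median l ≤ ·) at h2
  rw [abs_lt]
  constructor
  · by_contra hv
    have : l.countP (· ≤ median l) ≤ l.countP (fun x => ¬ |x - p| < ε) := by
      refine List.countP_mono_left fun a _ ha => ?_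
      have : a ≤ median l := by simpa using ha
      simp only [decide_eq_true_eq, abs_lt]
      intro h; linarith [h.1]
    lia
  · by_contra hv
    have : l.countP (median l ≤ ·) ≤ l.countP (fun x => ¬ |x - p| < ε) := by
      refine List.countP_mono_left fun a _ ha => ?_
      have : median l ≤ a := by simpa using ha
      simp only [decide_eq_true_eq, abs_lt]
      intro h; linarith [h.2]
    lia

namespace QueryAlgorithm

variable {H : Type*} [NormedAddCommGroup H] [InnerProductSpace ℂ H] {R₁ R₂ : H →L[ℂ] H}

lemma finalState_power (A : QueryAlgorithm) {φ : H} {a : A.Work → ℂ}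
    (h : ∀ w, A.finalState R₁ R₂ φ w = a w • φ) (n : ℕ) (w : (A.power n).Work) :
    (A.power n).finalState R₁ R₂ φ w = ((A.outcomes n w).map a).prod • φ := by
  induction n with
  | zero =>
    change φ = _
    simp [outcomes]
  | succ n ih =>
    obtain ⟨w, w'⟩ := w
    refine (finalState_seq _ _ _ _ _).trans ?_
    rw [ih, finalState_smul, Pi.smul_apply, h, smul_smul, mul_comm]
    rfl

lemma sum_prod_outcomes (A : QueryAlgorithm) (g : A.Work → ℝ) (n : ℕ) :
    ∑ w, ((A.outcomes n w).map g).prod = (∑ w, g w) ^ n := by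
  induction n with
  | zero => exact Fintype.sum_unique (ι := Unit) _
  | succ n ih =>
    refine (sum_work_seq _ _ _).trans ?_
    rw [pow_succ, ← ih, Finset.sum_mul_sum]
    refine Finset.sum_congr rfl fun w _ => Finset.sum_congr rfl fun w' _ => ?_
    rw [mul_comm]
    rfl

/-- If each of `2 * N` independent runs is bad with probability at most `1 / 4`, then the
probability that at least half of them are bad is at most `(3 / 4) ^ N`. Every bad run is given
the weight `3`; the total weight is then at most `(3 / 2) ^ (2 * N)`. -/
lemma sum_majority_bad_le (A : QueryAlgorithm) {q : A.Work → ℝ} (hq : ∀ w, 0 ≤ q w)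
    (hq1 : ∑ w, q w = 1) (B : A.Work → Prop) [DecidablePred B]
    (hB : ∑ w with B w, q w ≤ 1 / 4) (N : ℕ) :
    ∑ w with N ≤ (A.outcomes (2 * N) w).countP (fun v => B v), ((A.outcomes (2 * N) w).map q).prod
      ≤ (3 / 4) ^ N := by
  have hw : ∑ w, q w * (if B w then 3 else 1) ≤ 3 / 2 := by
    have : ∀ w, q w * (if B w then 3 else 1) = q w + 2 * (if B w then q w else 0) := by
      intro w; split_ifs <;> ring
    simp only [this, Finset.sum_add_distrib, hq1, ← Finset.mul_sum, ← Finset.sum_filter]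
    linarith
  have hlist : ∀ l : List A.Work, (l.map fun w => q w * (if B w then 3 else 1)).prod =
      (l.map q).prod * 3 ^ l.countP (fun v => B v) := by
    intro l
    induction l with
    | nil => simp
    | cons a l ih =>
      rw [List.map_cons, List.prod_cons, ih, List.map_cons, List.prod_cons, List.countP_cons]
      by_cases ha : B a <;> simp [ha, pow_succ] <;> ring
  have hpos : ∀ l : List A.Work, 0 ≤ (l.map q).prod := fun l =>
    List.prod_nonneg (by simpa using fun a _ => hq a)
  have h3 : (∑ w with N ≤ (A.outcomes (2 * N) w).countP (fun v => B v),
      ((A.outcomes (2 * N) w).map q).prod) * 3 ^ N ≤ (3 / 2) ^ (2 * N) := by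
    calc _ ≤ ∑ w, ((A.outcomes (2 * N) w).map fun w => q w * (if B w then 3 else 1)).prod := by
          rw [Finset.sum_filter, Finset.sum_mul]
          refine Finset.sum_le_sum fun w _ => ?_
          rw [hlist]
          split_ifs with h
          · have := hpos (A.outcomes (2 * N) w)
            gcongr
            norm_num
          · rw [zero_mul]
            exact mul_nonneg (hpos _) (by positivity)
      _ ≤ _ := by
          rw [sum_prod_outcomes]
          refine pow_le_pow_left₀ (Finset.sum_nonneg fun w _ => mul_nonneg (hq w) ?_) hw _
          split_ifs <;> norm_num
  rw [← le_div_iff₀ (by positivity)] at h3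
  refine h3.trans (le_of_eq ?_)
  rw [pow_mul, ← div_pow]
  norm_num

/-- If every run of `A` multiplies `φ` by a scalar and its estimate `c` of `p` is good with
probability at least `3 / 4`, then the median estimate of `2 * N` runs is bad with exponentially
small probability. -/
lemma sum_finalState_power_median_le (A : QueryAlgorithm) {φ : H} {a : A.Work → ℂ}
    (h : ∀ w, A.finalState R₁ R₂ φ w = a w • φ) (ha : ∑ w, ‖a w‖ ^ 2 = 1) (c : A.Work → ℝ)
    {p ε : ℝ} (hbad : ∑ w with ¬ |c w - p| < ε, ‖a w‖ ^ 2 ≤ 1 / 4) (N : ℕ) :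
    ∑ w with ¬ |median ((A.outcomes (2 * N) w).map c) - p| < ε,
      ‖(A.power (2 * N)).finalState R₁ R₂ φ w‖ ^ 2 ≤ (3 / 4) ^ N * ‖φ‖ ^ 2 := by
  have hmaj := A.sum_majority_bad_le (q := fun w => ‖a w‖ ^ 2) (fun w => by positivity) ha
    (fun w => ¬ |c w - p| < ε) hbad N
  have hlist : ∀ l : List A.Work,
      ‖(l.map a).prod‖ ^ 2 = (l.map fun w => ‖a w‖ ^ 2).prod := by
    intro l
    induction l with
    | nil => simp
    | cons a l ih => simp [mul_pow, ih]
  simp only [A.finalState_power h, norm_smul, mul_pow, hlist]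
  rw [← Finset.sum_mul]
  refine mul_le_mul_of_nonneg_right (le_trans ?_ hmaj) (by positivity)
  refine Finset.sum_le_sum_of_subset_of_nonneg (fun w hw => ?_) fun w _ _ =>
    List.prod_nonneg (by simp)
  rw [Finset.mem_filter] at hw ⊢
  refine ⟨hw.1, ?_⟩
  by_contra hlt
  refine hw.2 (abs_median_sub_lt ?_)
  rw [List.length_map, length_outcomes, List.countP_map]
  have : (A.outcomes (2 * N) w).countP ((fun x => decide ¬ |x - p| < ε) ∘ c) =
    (A.outcomes (2 * N) w).countP (fun v => ¬ |c v - p| < ε) := rfl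
  rw [this]
  lia

/-- The estimate of `p` on an outcome of phase estimation. -/
noncomputable def estimate (K : ℕ) [NeZero K] (U : Matrix.unitaryGroup (Fin K) ℂ) :
    (phaseEstimation K U).Work → ℝ :=
  phaseEstimate K

/-- Repeated phase estimation on `ψ`: the median estimate is bad with small probability. The two
eigenvectors that sum to `ψ` contribute at most `(3 / 4) ^ N` each, by the parallelogram law. -/
lemma sum_finalState_power_le {K : ℕ} [NeZero K] (hK : 2 ≤ K)
    {U : Matrix.unitaryGroup (Fin K) ℂ}
    (hU : ∀ k, (U : Matrix (Fin K) (Fin K) ℂ) k 0 = sineWindow K k) {ψ e : H} {β s : ℝ}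
    (hs : 0 < s) (hKs : 20 ≤ K ^ 2 * s ^ 2) (h : IsRotationPlane R₁ R₂ ψ e β) (N : ℕ) :
    ∑ w with ¬ |median (((phaseEstimation K U).outcomes (2 * N) w).map (estimate K U)) -
        (1 + Real.cos β) / 2| < |Real.sin β| * s + s ^ 2,
      ‖((phaseEstimation K U).power (2 * N)).finalState R₁ R₂ ψ w‖ ^ 2 ≤ 2 * (3 / 4) ^ N := by
  obtain ⟨φ, φ', rfl, hφ, hφ', he, he'⟩ := h.exists_eigenvectors
  have hbound : 5 / ((K : ℝ) ^ 2 * s ^ 2) ≤ 1 / 4 := by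
    rw [div_le_iff₀ (by linarith)]; linarith
  have h1 := sum_finalState_power_median_le _ (finalState_phaseEstimation K hU he)
    (sum_norm_sq_phaseAmplitude hK _) (estimate K U)
    ((sum_norm_sq_phaseAmplitude_bad_le hK _ hs).trans hbound) N
  have h2 := sum_finalState_power_median_le _ (finalState_phaseEstimation K hU he')
    (sum_norm_sq_phaseAmplitude hK _) (estimate K U)
    ((sum_norm_sq_phaseAmplitude_bad_le hK _ hs).trans hbound) N
  simp only [Real.cos_neg, Real.sin_neg, abs_neg] at h2
  simp only [finalState_add, Pi.add_apply]
  have h3 : ∀ x y : H, ‖x + y‖ ^ 2 ≤ 2 * ‖x‖ ^ 2 + 2 * ‖y‖ ^ 2 := fun x y => by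
    have := norm_add_le x y
    nlinarith [norm_nonneg (x + y), sq_nonneg (‖x‖ - ‖y‖)]
  refine (Finset.sum_le_sum fun w _ => h3 _ _).trans ?_
  rw [Finset.sum_add_distrib, ← Finset.mul_sum, ← Finset.mul_sum]
  have h4 : (0 : ℝ) ≤ (3 / 4) ^ N := by positivity
  nlinarith

end QueryAlgorithm

/-! ### Restoring the state -/

section Defect

variable {H : Type*} [NormedAddCommGroup H] [InnerProductSpace ℂ H]

/-- The squared norm of the component of `x` orthogonal to the unit vector `ψ`. -/
noncomputable def defect (ψ x : H) : ℝ := ‖x - inner ℂ ψ x • ψ‖ ^ 2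

lemma defect_nonneg (ψ x : H) : 0 ≤ defect ψ x := by unfold defect; positivity

lemma norm_inner_sq_eq {ψ : H} (hψ : ‖ψ‖ = 1) (x : H) :
    ‖inner ℂ ψ x‖ ^ 2 = ‖x‖ ^ 2 - defect ψ x := by
  have h1 : inner ℂ ψ ψ = 1 := by rw [inner_self_eq_norm_sq_to_K, hψ]; simp
  have h := norm_add_sq_eq_norm_sq_add_norm_sq_of_inner_eq_zero (𝕜 := ℂ) (x - inner ℂ ψ x • ψ)
    (inner ℂ ψ x • ψ) (by
      rw [inner_smul_right, inner_sub_left, inner_smul_left, inner_conj_symm, h1]; ring)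
  rw [sub_add_cancel, norm_smul, hψ, mul_one] at h
  rw [defect]
  linarith

namespace IsRotationPlane

variable {R₁ R₂ : H →L[ℂ] H} {ψ e : H} {β : ℝ}

lemma defect_eq (h : IsRotationPlane R₁ R₂ ψ e β) (a b : ℂ) :
    defect ψ (a • ψ + b • e) = ‖b‖ ^ 2 * ‖e‖ ^ 2 := by
  have h1 : inner ℂ ψ ψ = 1 := by rw [inner_self_eq_norm_sq_to_K, h.norm_eq]; simp
  rw [defect, inner_add_right, inner_smul_right, inner_smul_right, h.inner_eq, h1, mul_one,
    mul_zero, add_zero, add_sub_cancel_left, norm_smul, mul_pow]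

end IsRotationPlane

namespace QueryAlgorithm

variable {R₁ R₂ : H →L[ℂ] H}

lemma probRestored_eq (h₁ : IsReflection R₁) (h₂ : IsReflection R₂) (A : QueryAlgorithm) {ψ : H}
    (hψ : ‖ψ‖ = 1) :
    A.probRestored R₁ R₂ ψ = 1 - ∑ w, defect ψ (A.finalState R₁ R₂ ψ w) := by
  simp only [probRestored, norm_inner_sq_eq hψ, Finset.sum_sub_distrib]
  rw [sum_norm_sq_finalState h₁ h₂, hψ, one_pow]

lemma sum_defect_power_le {V : Submodule ℂ H} (h₁ : ∀ v ∈ V, R₁ v ∈ V) (h₂ : ∀ v ∈ V, R₂ v ∈ V)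
    (A : QueryAlgorithm) (ψ : H) {c : ℝ} (hc : 0 ≤ c)
    (hA : ∀ v ∈ V, ∑ w, defect ψ (A.finalState R₁ R₂ v w) ≤ c * defect ψ v) (n : ℕ) {v : H}
    (hv : v ∈ V) :
    ∑ w, defect ψ ((A.power n).finalState R₁ R₂ v w) ≤ c ^ n * defect ψ v := by
  induction n with
  | zero =>
    refine le_of_eq ((Fintype.sum_unique (ι := Unit) _).trans ?_)
    rw [pow_zero, one_mul]
    rfl
  | succ n ih =>
    refine (sum_work_seq _ _ _).trans_le ?_
    change ∑ w, ∑ w', defect ψ (((A.power n).seq A).finalState R₁ R₂ v (w, w')) ≤ _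
    simp only [finalState_seq]
    calc _ ≤ ∑ w, c * defect ψ ((A.power n).finalState R₁ R₂ v w) :=
          Finset.sum_le_sum fun w _ => hA _ (finalState_mem h₁ h₂ _ hv w)
      _ ≤ c * (c ^ n * defect ψ v) := by
          rw [← Finset.mul_sum]
          gcongr
      _ = _ := by ring

end QueryAlgorithm

end Defect

section Restoration

open OracleGate

/-- The Hadamard matrix on one qubit. -/
noncomputable def hadamard : Matrix Bool Bool ℂ :=
  fun a b => if a && b then -((Real.sqrt 2)⁻¹ : ℝ) else ((Real.sqrt 2)⁻¹ : ℝ)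

lemma inv_sqrt_two_mul_self :
    (((Real.sqrt 2)⁻¹ : ℝ) : ℂ) * (((Real.sqrt 2)⁻¹ : ℝ) : ℂ) = 1 / 2 := by
  rw [← Complex.ofReal_mul, ← mul_inv, Real.mul_self_sqrt (by norm_num)]
  norm_num

lemma hadamard_mem : hadamard ∈ Matrix.unitaryGroup Bool ℂ := by
  have h := inv_sqrt_two_mul_self
  rw [Matrix.mem_unitaryGroup_iff]
  ext a b
  push_cast at h
  cases a <;> cases b <;> simp [hadamard, Matrix.mul_apply, h]
  norm_num

/-- One round of restoration. A qubit records whether the system is in `ψ` (value `true`) or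
orthogonal to `ψ`; in the latter case `R₁ R₂` is applied `k` times, for `k` uniform below `K`. -/
noncomputable def restoration (K : ℕ) [NeZero K] : QueryAlgorithm where
  Work := Bool × Fin K
  init := (false, 0)
  gates := [work ⟨Matrix.kronecker hadamard (fourierMatrix K),
      Matrix.kronecker_mem_unitary hadamard_mem (fourierMatrix_mem K)⟩,
    queryFst (Finset.univ.filter fun w => w.1 = true),
    work ⟨Matrix.kronecker hadamard (1 : Matrix (Fin K) (Fin K) ℂ),
      Matrix.kronecker_mem_unitary hadamard_mem (one_mem _)⟩] ++
    walkGates (fun w => if w.1 then 0 else (w.2 : ℕ)) K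
  output _ := 0

lemma queries_restoration (K : ℕ) [NeZero K] : (restoration K).queries = 2 * K + 1 := by
  have : ∀ U V : Matrix.unitaryGroup (Bool × Fin K) ℂ, costList ([work U,
      queryFst (Finset.univ.filter fun w => w.1 = true), work V] ++
      walkGates (fun w => if w.1 then 0 else (w.2 : ℕ)) K) = 2 * K + 1 := by
    intro U V
    simp [costList_walkGates, cost]
    ring
  exact this _ _

variable {H : Type*} [NormedAddCommGroup H] [InnerProductSpace ℂ H] {R₁ R₂ : H →L[ℂ] H}

lemma finalState_restoration (K : ℕ) [NeZero K] (v : H) (b : Bool) (k : Fin K) :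
    (restoration K).finalState R₁ R₂ v (b, k) =
      (fun v => R₁ (R₂ v))^[if b then 0 else (k : ℕ)]
        ((((Real.sqrt K)⁻¹ : ℝ) : ℂ) • (1 / 2 : ℂ) • (v + (if b then (-1 : ℂ) else 1) • R₁ v)) := by
  have key : run R₁ R₂ ([work ⟨Matrix.kronecker hadamard (fourierMatrix K),
      Matrix.kronecker_mem_unitary hadamard_mem (fourierMatrix_mem K)⟩,
      queryFst (Finset.univ.filter fun w => w.1 = true),
      work ⟨Matrix.kronecker hadamard (1 : Matrix (Fin K) (Fin K) ℂ),
        Matrix.kronecker_mem_unitary hadamard_mem (one_mem _)⟩] ++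
      walkGates (fun w => if w.1 then 0 else (w.2 : ℕ)) K)
      (fun w => if w = (false, 0) then v else 0) (b, k) =
      (fun v => R₁ (R₂ v))^[if b then 0 else (k : ℕ)]
        ((((Real.sqrt K)⁻¹ : ℝ) : ℂ) • (1 / 2 : ℂ) •
          (v + (if b then (-1 : ℂ) else 1) • R₁ v)) := by
    have h := inv_sqrt_two_mul_self
    have hk : (if b then 0 else (k : ℕ)) ≤ K := by split_ifs; exacts [Nat.zero_le _, k.2.le]
    rw [run_append, run_walkGates, min_eq_left hk]
    congr 1
    push_cast at h
    cases b
    · simp [apply, Fintype.sum_prod_type, Matrix.one_apply, hadamard, fourierMatrix]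
      match_scalars <;> linear_combination ((Real.sqrt K : ℂ)⁻¹) * h
    · simp [apply, Fintype.sum_prod_type, Matrix.one_apply, hadamard, fourierMatrix]
      match_scalars
      · linear_combination (-(Real.sqrt K : ℂ)⁻¹) * h
      · linear_combination ((Real.sqrt K : ℂ)⁻¹) * h
  exact key

lemma sum_defect_restoration (K : ℕ) [NeZero K] {ψ e : H} {β : ℝ}
    (h : IsRotationPlane R₁ R₂ ψ e β) {v : H} (hv : v ∈ Submodule.span ℂ {ψ, e}) :
    ∑ w, defect ψ ((restoration K).finalState R₁ R₂ v w) =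
      (∑ k : Fin K, Real.cos (k * β) ^ 2) / K * defect ψ v := by
  obtain ⟨a, b, rfl⟩ := Submodule.mem_span_pair.1 hv
  refine (Fintype.sum_prod_type (γ := ℝ) _).trans ?_
  rw [Fintype.sum_bool]
  set r : ℂ := (((Real.sqrt K)⁻¹ : ℝ) : ℂ) with hr
  have hr2 : ‖r‖ ^ 2 = (K : ℝ)⁻¹ := by
    rw [hr, Complex.norm_real, Real.norm_eq_abs, sq_abs, inv_pow, Real.sq_sqrt (by positivity)]
  have ht : ∀ k : Fin K, defect ψ ((restoration K).finalState R₁ R₂ (a • ψ + b • e) (true, k)) =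
      0 := by
    intro k
    rw [finalState_restoration]
    have : r • (1 / 2 : ℂ) • (a • ψ + b • e +
        (if (true : Bool) then (-1 : ℂ) else 1) • R₁ (a • ψ + b • e)) =
        (r * a) • ψ + (0 : ℂ) • e := by
      rw [map_add, map_smul, map_smul, h.fst_self, h.fst_orth, if_pos rfl]
      module
    rw [this, if_pos rfl, Function.iterate_zero, id, h.defect_eq]
    simp
  have hf : ∀ k : Fin K, defect ψ ((restoration K).finalState R₁ R₂ (a • ψ + b • e) (false, k)) =
      Real.cos (k * β) ^ 2 / K * defect ψ (a • ψ + b • e) := by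
    intro k
    rw [finalState_restoration]
    have : r • (1 / 2 : ℂ) • (a • ψ + b • e +
        (if (false : Bool) then (-1 : ℂ) else 1) • R₁ (a • ψ + b • e)) = (r * b) • e := by
      rw [map_add, map_smul, map_smul, h.fst_self, h.fst_orth, if_neg Bool.false_ne_true]
      module
    have hit : ∀ n : ℕ, (fun v => R₁ (R₂ v))^[n] ((r * b) • e) =
        (r * b) • (fun v => R₁ (R₂ v))^[n] e := by
      intro n
      induction n with
      | zero => rfl
      | succ n ih => rw [Function.iterate_succ_apply', ih, Function.iterate_succ_apply', map_smul,
          map_smul]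
    rw [this, if_neg Bool.false_ne_true, hit, h.iterate_orth, smul_add, smul_smul, smul_smul,
      h.defect_eq, h.defect_eq, norm_mul, norm_mul, mul_pow, mul_pow, hr2, Complex.norm_real,
      Real.norm_eq_abs, sq_abs]
    ring
  simp only [ht, hf, Finset.sum_const_zero, zero_add]
  rw [← Finset.sum_mul, ← Finset.sum_div]

lemma sum_cos_sq_le (K : ℕ) (β : ℝ) : ∑ k : Fin K, Real.cos (k * β) ^ 2 ≤ K := by
  refine (Finset.sum_le_sum fun k _ => Real.cos_sq_le_one _).trans ?_
  simp

lemma sum_cos_sq_le_of_sin {K : ℕ} {β : ℝ} (hβ : 0 < Real.sin β) (hK : 2 ≤ K * Real.sin β) :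
    ∑ k : Fin K, Real.cos (k * β) ^ 2 ≤ 3 / 4 * K := by
  -- The sum of the `cos (2kβ)` telescopes after multiplication by `2 sin β`.
  have htel : ∀ n : ℕ, 2 * Real.sin β * ∑ k ∈ Finset.range n, Real.cos (2 * (k * β)) =
      Real.sin ((2 * n - 1) * β) + Real.sin β := by
    intro n
    induction n with
    | zero => simp
    | succ n ih =>
      rw [Finset.sum_range_succ, mul_add, ih]
      have h1 : (2 * ((n + 1 : ℕ) : ℝ) - 1) * β = 2 * (n * β) + β := by push_cast; ring
      have h2 : (2 * (n : ℝ) - 1) * β = 2 * (n * β) - β := by ring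
      rw [h1, h2, Real.sin_add, Real.sin_sub]
      ring
  rw [Fin.sum_univ_eq_sum_range (fun k => Real.cos (k * β) ^ 2) K]
  simp only [Real.cos_sq, Finset.sum_add_distrib, Finset.sum_const, Finset.card_range,
    nsmul_eq_mul, ← Finset.sum_div]
  have h1 := htel K
  set S := ∑ k ∈ Finset.range K, Real.cos (2 * (k * β))
  have h2 : Real.sin β * S ≤ 1 := by
    have := Real.sin_le_one ((2 * K - 1) * β)
    have := Real.sin_le_one β
    linarith
  have h3 : S ≤ K / 2 := by
    by_contra hlt
    have := mul_lt_mul_of_pos_left (not_le.1 hlt) hβ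
    linarith
  linarith

end Restoration

/-! ### The estimate and its rounding -/

/-- The estimate `x`, replaced by `0` if it is below `1 / (2 * t ^ 2)` and by `1` if it is above
`1 - 1 / (2 * t ^ 2)`. -/
noncomputable def roundToEnds (t x : ℝ) : ℝ :=
  if x < 1 / (2 * t ^ 2) then 0 else if 1 - 1 / (2 * t ^ 2) < x then 1 else x

section Rounding

variable {t x p : ℝ}

lemma roundToEnds_mem_Icc (t x : ℝ) : roundToEnds t x ∈ Set.Icc (0 : ℝ) 1 := by
  have h : 0 ≤ 1 / (2 * t ^ 2) := by positivity
  unfold roundToEnds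
  split_ifs with h1 h2
  · simp
  · simp
  · exact ⟨by linarith, by linarith⟩

lemma abs_roundToEnds_sub_lt (ht : 1 ≤ t) (hp0 : 0 ≤ p) (hp1 : p ≤ 1)
    (h : |x - p| < 2 * √(p * (1 - p)) * (1 / (5 * t)) + (1 / (5 * t)) ^ 2) :
    |roundToEnds t x - p| < √(p * (1 - p)) / t + 1 / t ^ 2 := by
  have hq : 0 ≤ √(p * (1 - p)) / t := by positivity
  have hT : 0 < 1 / t ^ 2 := by positivity
  have h1 : 2 * √(p * (1 - p)) * (1 / (5 * t)) + (1 / (5 * t)) ^ 2 =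
      2 / 5 * (√(p * (1 - p)) / t) + 1 / 25 * (1 / t ^ 2) := by field_simp; ring
  have h2 : 1 / (2 * t ^ 2) = 1 / 2 * (1 / t ^ 2) := by field_simp
  rw [h1, abs_lt] at h
  unfold roundToEnds
  rw [h2, abs_lt]
  split_ifs with h3 h4 <;> constructor <;> linarith

/-- An estimate of accuracy `2 √(p (1 - p)) s + s ^ 2`, with `s = 1 / (5 t)`, stays below the rounding
threshold when `p ≤ 1 / (4 t ^ 2)`. -/
lemma add_accuracy_lt_of_le (ht : 1 ≤ t) (hp0 : 0 ≤ p) (hp : p ≤ 1 / (4 * t ^ 2)) :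
    p + (2 * √(p * (1 - p)) * (1 / (5 * t)) + (1 / (5 * t)) ^ 2) < 1 / (2 * t ^ 2) := by
  have hT : 0 < 1 / t ^ 2 := by positivity
  have h2 : 1 / (2 * t ^ 2) = 1 / 2 * (1 / t ^ 2) := by field_simp
  have h4 : 1 / (4 * t ^ 2) = 1 / 4 * (1 / t ^ 2) := by field_simp
  have hq : √(p * (1 - p)) ≤ 1 / (2 * t) := by
    refine Real.sqrt_le_iff.2 ⟨by positivity, ?_⟩
    have : (1 / (2 * t)) ^ 2 = 1 / (4 * t ^ 2) := by field_simp; norm_num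
    nlinarith
  have h5 : 2 * √(p * (1 - p)) * (1 / (5 * t)) ≤ 2 * (1 / (2 * t)) * (1 / (5 * t)) := by gcongr
  have h6 : 2 * (1 / (2 * t)) * (1 / (5 * t)) = 1 / 5 * (1 / t ^ 2) := by field_simp
  have h7 : (1 / (5 * t)) ^ 2 = 1 / 25 * (1 / t ^ 2) := by field_simp; norm_num
  rw [h4] at hp
  rw [h2, h7]
  linarith

lemma roundToEnds_eq_zero (ht : 1 ≤ t) (hp0 : 0 ≤ p) (hp : p ≤ 1 / (4 * t ^ 2))
    (h : |x - p| < 2 * √(p * (1 - p)) * (1 / (5 * t)) + (1 / (5 * t)) ^ 2) :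
    roundToEnds t x = 0 := by
  have := add_accuracy_lt_of_le ht hp0 hp
  rw [abs_lt] at h
  exact if_pos (by linarith)

lemma roundToEnds_eq_one (ht : 1 ≤ t) (hp1 : p ≤ 1) (hp : 1 - p ≤ 1 / (4 * t ^ 2))
    (h : |x - p| < 2 * √(p * (1 - p)) * (1 / (5 * t)) + (1 / (5 * t)) ^ 2) :
    roundToEnds t x = 1 := by
  have h1 := add_accuracy_lt_of_le ht (by linarith) hp
  rw [sub_sub_cancel, mul_comm (1 - p)] at h1
  have h2 : 1 / (2 * t ^ 2) ≤ 1 / 2 := by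
    apply one_div_le_one_div_of_le <;> nlinarith
  rw [abs_lt] at h
  rw [roundToEnds, if_neg (by linarith), if_pos (by linarith)]

end Rounding

/-! ### The algorithm -/

namespace QueryAlgorithm

/-- Nondestructive amplitude estimation: the rounded median of `2 * N` phase estimations is
evaluated coherently, then `N` rounds of restoration follow. -/
noncomputable def amplitudeEstimation (K : ℕ) [NeZero K] (U : Matrix.unitaryGroup (Fin K) ℂ)
    (N : ℕ) (t : ℝ) : QueryAlgorithm :=
  (((phaseEstimation K U).power (2 * N)).coherent fun w =>
    roundToEnds t (median (((phaseEstimation K U).outcomes (2 * N) w).map (estimate K U)))).seq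
    ((restoration K).power N)

lemma queries_amplitudeEstimation (K : ℕ) [NeZero K] (U : Matrix.unitaryGroup (Fin K) ℂ)
    (N : ℕ) (t : ℝ) : (amplitudeEstimation K U N t).queries = 10 * N * K + N := by
  rw [amplitudeEstimation, queries_seq, queries_coherent, queries_power, queries_power,
    queries_phaseEstimation, queries_restoration]
  ring

variable {H : Type*} [NormedAddCommGroup H] [InnerProductSpace ℂ H] {R₁ R₂ : H →L[ℂ] H}

/-- Rounds of restoration that reduce the defect by the factor `c` leave the defect of the state
before them, multiplied by `c ^ N`. -/
lemma one_sub_le_probRestored_seq_power (h₁ : IsReflection R₁) (h₂ : IsReflection R₂)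
    {ψ e : H} {β : ℝ} (h : IsRotationPlane R₁ R₂ ψ e β) (A : QueryAlgorithm) (K : ℕ) [NeZero K]
    {c : ℝ} (hc : (∑ k : Fin K, Real.cos (k * β) ^ 2) / K ≤ c) (N : ℕ) :
    1 - c ^ N * (1 - A.probRestored R₁ R₂ ψ) ≤
      (A.seq ((restoration K).power N)).probRestored R₁ R₂ ψ := by
  have hψ := h.norm_eq
  have hmem : ψ ∈ Submodule.span ℂ {ψ, e} := Submodule.subset_span (by simp)
  have hc0 : 0 ≤ c := le_trans (div_nonneg (Finset.sum_nonneg fun _ _ => sq_nonneg _)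
    (Nat.cast_nonneg K)) hc
  rw [probRestored_eq h₁ h₂ _ hψ, probRestored_eq h₁ h₂ _ hψ, sub_sub_cancel, sum_work_seq]
  refine sub_le_sub_left ?_ 1
  simp only [finalState_seq]
  rw [Finset.mul_sum]
  refine Finset.sum_le_sum fun w _ => ?_
  refine sum_defect_power_le h.fst_mem h.snd_mem _ ψ hc0 (fun v hv => ?_) N
    (finalState_mem h.fst_mem h.snd_mem A hmem w)
  rw [sum_defect_restoration K h hv]
  exact mul_le_mul_of_nonneg_right hc (defect_nonneg _ _)

end QueryAlgorithm

lemma exists_pow_le_and_le_log {η : ℝ} (hη : 0 < η) (hη' : η < 1 / 2) :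
    ∃ N : ℕ, (3 / 4 : ℝ) ^ N ≤ η / 4 ∧ (N : ℝ) ≤ 14 * Real.log (1 / η) := by
  set L := Real.log (1 / η) with hL
  have hL2 : 0.69 ≤ L := by
    have h1 : Real.log 2 ≤ L := Real.log_le_log (by norm_num) (by
      rw [le_div_iff₀ hη]; linarith)
    linarith [Real.log_two_gt_d9]
  refine ⟨⌈12 * L⌉₊, ?_, ?_⟩
  -- `(3 / 4) ^ N ≤ exp (-N / 4) ≤ η ^ 3`, and `η ^ 2 ≤ 1 / 4`.
  · have h1 : (3 / 4 : ℝ) ≤ Real.exp (-(1 / 4)) := by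
      have := Real.add_one_le_exp (-(1 / 4) : ℝ)
      linarith
    have h2 : Real.exp (-L) = η := by rw [hL, one_div, Real.log_inv, neg_neg, Real.exp_log hη]
    calc (3 / 4 : ℝ) ^ ⌈12 * L⌉₊ ≤ Real.exp (-(1 / 4)) ^ ⌈12 * L⌉₊ := by gcongr
      _ = Real.exp (⌈12 * L⌉₊ * -(1 / 4)) := by rw [Real.exp_nat_mul]
      _ ≤ Real.exp ((3 : ℕ) * -L) := by
          refine Real.exp_le_exp.2 ?_
          have := Nat.le_ceil (12 * L)
          push_cast
          linarith
      _ = η ^ 3 := by rw [Real.exp_nat_mul, h2]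
      _ ≤ η / 4 := by nlinarith [mul_pos hη hη]
  · have := (Nat.ceil_lt_add_one (by linarith : (0 : ℝ) ≤ 12 * L)).le
    linarith

open QueryAlgorithm in
theorem propositionB2 :
    ∃ C : ℝ, 0 < C ∧ ∀ t η : ℝ, 1 ≤ t → 0 < η → η < 1 / 2 →
      ∃ A : QueryAlgorithm,
        (A.queries : ℝ) ≤ C * (t * Real.log (1 / η)) ∧
        (∀ w, A.output w ∈ Set.Icc (0 : ℝ) 1) ∧
        ∀ (H : Type*) [NormedAddCommGroup H] [InnerProductSpace ℂ H] [CompleteSpace H]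
          (ψ : H) (P : H →L[ℂ] H) (p : ℝ),
          ‖ψ‖ = 1 → IsStarProjection P → p = ‖P ψ‖ ^ 2 →
            1 - η ≤ A.probOutput (stateReflection ψ) (projReflection P) ψ
              (fun q => |q - p| < Real.sqrt (p * (1 - p)) / t + 1 / t ^ 2) ∧
            (p ≤ 1 / (4 * t ^ 2) →
              1 - η ≤ A.probOutput (stateReflection ψ) (projReflection P) ψ (fun q => q = 0)) ∧
            1 - η ≤ A.probRestored (stateReflection ψ) (projReflection P) ψ := by
  refine ⟨4000, by norm_num, fun t η ht hη hη' => ?_⟩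
  obtain ⟨N, hN, hNlog⟩ := exists_pow_le_and_le_log hη hη'
  -- For `s = 1 / (5 t)` the bound `5 / (K ^ 2 * s ^ 2)` on a failed phase estimation is at most
  -- `1 / 4` as soon as `K ≥ √500 t`.
  set K := ⌈23 * t⌉₊ with hKdef
  have hKt : 23 * t ≤ K := Nat.le_ceil _
  have hKt' : (K : ℝ) ≤ 24 * t := by
    have := (Nat.ceil_lt_add_one (by linarith : (0 : ℝ) ≤ 23 * t)).le
    rw [← hKdef] at this
    linarith
  have hK2 : 2 ≤ K := by
    have : (2 : ℝ) ≤ K := by linarith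
    exact_mod_cast this
  have : NeZero K := ⟨by lia⟩
  obtain ⟨U, hU⟩ := exists_unitary_column (0 : Fin K) (fun k => (sineWindow K k : ℂ)) (by
    rw [← sum_sineWindow_sq hK2]
    exact Finset.sum_congr rfl fun k _ => by rw [Complex.norm_real, Real.norm_eq_abs, sq_abs])
  refine ⟨amplitudeEstimation K U N t, ?_, fun w => ?_, ?_⟩
  · rw [queries_amplitudeEstimation]
    push_cast
    have hL : 0 ≤ Real.log (1 / η) := Real.log_nonneg (by rw [le_div_iff₀ hη]; linarith)
    have h1 : (N : ℝ) * K ≤ (14 * Real.log (1 / η)) * (24 * t) := by gcongr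
    have h2 : (N : ℝ) ≤ N * K := le_mul_of_one_le_right (by positivity) (by linarith)
    have h3 : 0 ≤ t * Real.log (1 / η) := by positivity
    linarith
  · obtain ⟨v, hv⟩ := w.1.2.2
    change (w.1.2 : ℝ) ∈ _
    rw [← hv]
    exact roundToEnds_mem_Icc t _
  intro H _ _ _ ψ P p hψ hP hp
  have h₁ := isReflection_stateReflection hψ
  have h₂ := isReflection_projReflection hP
  have hp0 : 0 ≤ p := by rw [hp]; positivity
  have hp1 : p ≤ 1 := by
    rw [hp]
    exact pow_le_one₀ (norm_nonneg _) ((P.le_of_opNorm_le hP.norm_le ψ).trans (by rw [hψ, one_mul]))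
  have hcos : Real.cos (Real.arccos (2 * p - 1)) = 2 * p - 1 :=
    Real.cos_arccos (by linarith) (by linarith)
  have hsin : Real.sin (Real.arccos (2 * p - 1)) = 2 * √(p * (1 - p)) := by
    rw [Real.sin_arccos, show 1 - (2 * p - 1) ^ 2 = 2 ^ 2 * (p * (1 - p)) by ring,
      Real.sqrt_mul (by norm_num), Real.sqrt_sq (by norm_num)]
  obtain ⟨e, he⟩ := exists_isRotationPlane hψ hP hp hcos hsin hp1
  set β := Real.arccos (2 * p - 1)
  set R₁ := stateReflection ψ
  set R₂ := projReflection P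
  set A := (phaseEstimation K U).power (2 * N) with hA
  set m : A.Work → ℝ := fun w =>
    median (((phaseEstimation K U).outcomes (2 * N) w).map (estimate K U)) with hm
  set ε := 2 * √(p * (1 - p)) * (1 / (5 * t)) + (1 / (5 * t)) ^ 2 with hε
  -- The median estimate is good up to probability `η / 2`.
  have hgood : 1 - η / 2 ≤ ∑ w with |m w - p| < ε, ‖A.finalState R₁ R₂ ψ w‖ ^ 2 := by
    have hKs : 20 ≤ (K : ℝ) ^ 2 * (1 / (5 * t)) ^ 2 := by
      rw [← mul_pow, mul_one_div]
      have : 23 / 5 ≤ (K : ℝ) / (5 * t) := by rw [le_div_iff₀ (by positivity)]; linarith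
      nlinarith
    have hbad := sum_finalState_power_le hK2 hU (by positivity) hKs he N
    have htot := sum_norm_sq_finalState h₁ h₂ A ψ
    rw [← Finset.sum_filter_add_sum_filter_not _ (fun w => |m w - p| < ε), hψ] at htot
    rw [hcos, hsin, abs_of_nonneg (by positivity),
      show (1 + (2 * p - 1)) / 2 = p by ring] at hbad
    have hbad' : ∑ w with ¬ |m w - p| < ε, ‖A.finalState R₁ R₂ ψ w‖ ^ 2 ≤ 2 * (3 / 4) ^ N := hbad
    linarith
  have hmono : ∀ E : A.Work → Prop, (∀ w, |m w - p| < ε → E w) → ∀ [DecidablePred E],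
      1 - η / 2 ≤ ∑ w with E w, ‖A.finalState R₁ R₂ ψ w‖ ^ 2 := by
    intro E hE _
    refine hgood.trans (Finset.sum_le_sum_of_subset_of_nonneg (fun w hw => ?_)
      fun _ _ _ => by positivity)
    rw [Finset.mem_filter] at hw ⊢
    exact ⟨hw.1, hE w hw.2⟩
  have hout : ∀ E : ℝ → Prop, (∀ w, |m w - p| < ε → E (roundToEnds t (m w))) →
      1 - η ≤ (amplitudeEstimation K U N t).probOutput R₁ R₂ ψ E := by
    intro E hE
    rw [amplitudeEstimation, probOutput_seq h₁ h₂, probOutput_coherent h₁ h₂]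
    classical
    have := hmono (fun w => E (roundToEnds t (m w))) hE
    exact le_trans (by linarith) this
  refine ⟨hout _ fun w hw => abs_roundToEnds_sub_lt ht hp0 hp1 hw,
    fun hp => hout _ fun w hw => roundToEnds_eq_zero ht hp0 hp hw, ?_⟩
  have hend : ∀ c : ℝ, (∀ w, |m w - p| < ε → roundToEnds t (m w) = c) →
      1 - η ≤ (amplitudeEstimation K U N t).probRestored R₁ R₂ ψ := by
    -- Restoration has no guaranteed gain near the ends, so only the factor `1` is used for it.
    intro c hc
    have h3 := hmono (fun w => roundToEnds t (m w) = c) hc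
    have h4 := sq_le_probRestored_coherent h₁ h₂ A (fun w => roundToEnds t (m w)) ψ c
    have h5 := one_sub_le_probRestored_seq_power h₁ h₂ he
      (A.coherent fun w => roundToEnds t (m w)) K
      (div_le_one_of_le₀ (sum_cos_sq_le K β) (Nat.cast_nonneg K)) N
    rw [one_pow, one_mul, sub_sub_cancel] at h5
    have h6 : (1 - η / 2) ^ 2 ≤ _ := pow_le_pow_left₀ (by linarith) h3 2
    refine le_trans ?_ (h6.trans (h4.trans h5))
    nlinarith
  by_cases hlow : p ≤ 1 / (4 * t ^ 2)
  · exact hend 0 fun w hw => roundToEnds_eq_zero ht hp0 hlow hw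
  by_cases hhigh : 1 - p ≤ 1 / (4 * t ^ 2)
  · exact hend 1 fun w hw => roundToEnds_eq_one ht hp1 hhigh hw
  -- Away from the ends the rotation angle is at least of order `1 / t`.
  have hK0 : (0 : ℝ) < K := by linarith
  have hsq : 1 / (4 * t) ≤ √(p * (1 - p)) := by
    refine Real.le_sqrt_of_sq_le ?_
    have h3 : (1 / (4 * t)) ^ 2 = 1 / 4 * (1 / (4 * t ^ 2)) := by field_simp
    have h4 : 1 / (4 * t ^ 2) ≤ 1 / 4 := by
      apply one_div_le_one_div_of_le <;> nlinarith
    have h5 : 0 < 1 / (4 * t ^ 2) := by positivity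
    rw [h3]
    nlinarith [mul_pos (sub_pos.2 (not_le.1 hlow)) (sub_pos.2 (not_le.1 hhigh))]
  have hsin0 : 1 / (2 * t) ≤ Real.sin β := by
    rw [hsin]
    have : 1 / (2 * t) = 2 * (1 / (4 * t)) := by field_simp; norm_num
    linarith
  have hc := sum_cos_sq_le_of_sin (K := K) (lt_of_lt_of_le (by positivity) hsin0) (by
    calc (2 : ℝ) ≤ 23 * t * (1 / (2 * t)) := by field_simp; norm_num
      _ ≤ K * Real.sin β := by gcongr)
  refine le_trans ?_ (one_sub_le_probRestored_seq_power h₁ h₂ he _ K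
    ((div_le_iff₀ hK0).2 hc) N)
  have h3 : 0 ≤ (A.coherent fun w => roundToEnds t (m w)).probRestored R₁ R₂ ψ :=
    Finset.sum_nonneg fun _ _ => by positivity
  have h4 : (0 : ℝ) ≤ (3 / 4) ^ N := by positivity
  have h5 : (3 / 4 : ℝ) ^ N *
      (1 - (A.coherent fun w => roundToEnds t (m w)).probRestored R₁ R₂ ψ) ≤ (3 / 4) ^ N := by
    nlinarith
  linarith
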